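/- All posets are finite. In a poset $P$, let $\mathrm{Irr}(P)$ be the set of elements with at most one lower cover and at most one upper cover, $\mathrm{Red}(P)=P\setminus\mathrm{Irr}(P)$, and $\mathrm{Irr}^*(P)$ the set of elements with exactly one lower cover and exactly one upper cover. An element of a lattice is reducible if it is the join or the meet of two elements different from it. The nullity of a poset is $e-v+c$, where $e$, $v$, $c$ are the numbers of edges, vertices and connected components of its cover graph. A block is a lattice whose least element is meet-reducible and whose greatest element is join-reducible. An element $x\in\mathrm{Irr}(P)$ is retractible if either there are no $y,z\in\mathrm{Red}(P)$ with $y\prec x\prec z$, or there are such $y,z$ and $y\prec x\prec z$ is the only directed path from $y$ to $z$. A basic block associated to $P$ is obtained from $P$ by successively removing retractible elements of $\mathrm{Irr}^*$ until none is left, and then successively removing all pendant vertices (elements of degree one in the cover graph). Let $B_{13}$ be the lattice on the nine elements $0,x,c_1,c_2,a,b,y,c_3,1$ whose covering relations are $0\prec x,c_1,c_2\prec a\prec b\prec y,c_3\prec 1$, and let $B_{14}$ be its dual. For $i\in\{13,14\}$ let $\mathbb B_i(j;4,3)$ be the class, up to isomorphism, of blocks on $j$ elements that have exactly four reducible elements,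 these being pairwise comparable, that have nullity three, and whose associated basic block is $B_i$. Let $P_n^k$ be the number of partitions of $n$ into exactly $k$ positive parts. Then for every integer $j\ge 9$, $$|\mathbb B_{13}(j;4,3)|=|\mathbb B_{14}(j;4,3)|=\sum_{r=0}^{j-9}\ \sum_{p=5}^{j-r-4}P^{3}_{p-2}\,P^{2}_{j-p-r-2}.$$ -/

import Mathlib

namespace LatticeCount

section Posets

variable (P : Type*) [PartialOrder P]

/-- The doubly irreducible elements of a poset: at most one lower cover, at most one upper cover. -/
def Irr : Set P := {x | {y | y ⋖ x}.Subsingleton ∧ {z | x ⋖ z}.Subsingleton}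

/-- The elements with exactly one lower cover and exactly one upper cover. -/
def IrrStar : Set P := {x | (∃! y, y ⋖ x) ∧ (∃! z, x ⋖ z)}

/-- The reducible elements of a poset: those that are not doubly irreducible. -/
def Red : Set P := (Irr P)ᶜ

/-- The nullity (edges minus vertices plus connected components) of the cover graph. -/
noncomputable def nullity : ℤ :=
  ((SimpleGraph.hasse P).edgeSet.ncard : ℤ) - (Nat.card P : ℤ)
    + (Nat.card (SimpleGraph.hasse P).ConnectedComponent : ℤ)

variable {P}

/-- `x` is retractible: it is doubly irreducible, and either it does not lie between two reducible
elements `y ⋖ x ⋖ z`, or it does and the path `y ⋖ x ⋖ z` is the only directed path from `y` to `z`.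
(In a finite poset, another directed path from `y` to `z` is the same thing as
another element strictly between `y` and `z`.) -/
def IsRetractible (x : P) : Prop :=
  x ∈ Irr P ∧
    ((¬ ∃ y ∈ Red P, ∃ z ∈ Red P, y ⋖ x ∧ x ⋖ z) ∨
      (∃ y ∈ Red P, ∃ z ∈ Red P, y ⋖ x ∧ x ⋖ z ∧ ∀ w, y < w → w < z → w = x))

/-- `x` is pendant: it has degree one in the cover graph. -/
def IsPendant (x : P) : Prop := ((SimpleGraph.hasse P).neighborSet x).ncard = 1

/-- The subposet `T` arises from the subposet `S` by removing one retractible element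
of `IrrStar S`. -/
def RetractStep (S T : Set P) : Prop :=
  ∃ x : S, x ∈ IrrStar S ∧ IsRetractible x ∧ T = S \ {(x : P)}

/-- The subposet `T` arises from the subposet `S` by removing one pendant element of `S`. -/
def PendantStep (S T : Set P) : Prop :=
  ∃ x : S, IsPendant x ∧ T = S \ {(x : P)}

/-- A basic retract: no element of `IrrStar P` is retractible. -/
def IsBasicRetract (P : Type*) [PartialOrder P] : Prop :=
  ∀ x ∈ IrrStar P, ¬ IsRetractible x

/-- `B` is (isomorphic to) a basic block associated to `P`: successive removal of retractible
elements leads from `P` to a basic retract `R`, from which successive removal of all pendant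
elements leads to a subposet isomorphic to `B`. -/
def IsBasicBlockOf (B P : Type*) [PartialOrder B] [PartialOrder P] : Prop :=
  ∃ R S : Set P,
    Relation.ReflTransGen RetractStep Set.univ R ∧ IsBasicRetract R ∧
    Relation.ReflTransGen PendantStep R S ∧ (∀ x : S, ¬ IsPendant x) ∧
    Nonempty (B ≃o S)

end Posets

section Lattices

variable (L : Type*) [Lattice L]

def MeetReducible {L : Type*} [Lattice L] (a : L) : Prop := ∃ b c, b ≠ a ∧ c ≠ a ∧ b ⊓ c = a

def JoinReducible {L : Type*} [Lattice L] (a : L) : Prop := ∃ b c, b ≠ a ∧ c ≠ a ∧ b ⊔ c = a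

/-- The reducible elements of a lattice. -/
def reducibles : Set L := {a | MeetReducible a ∨ JoinReducible a}

/-- A block: the least element is meet-reducible and the greatest element is join-reducible. -/
def IsBlock : Prop :=
  (∃ b : L, IsBot b ∧ MeetReducible b) ∧ (∃ t : L, IsTop t ∧ JoinReducible t)

/-- A block with exactly `r` reducible elements, pairwise comparable, and with nullity `k`. -/
structure IsBlockOfType (r k : ℕ) : Prop where
  isBlock : IsBlock L
  card_reducibles : (reducibles L).ncard = r
  comparable : IsChain (· ≤ ·) (reducibles L)
  nullity_eq : nullity L = k

end Lattices

/-- The lattice structures on `j` labelled points that are blocks with `r` reducible elements, all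
comparable, with nullity `k`, and with associated basic block `B`. -/
def BlockOn (B : Type*) [PartialOrder B] (j r k : ℕ) : Type :=
  {L : Lattice (Fin j) // @IsBlockOfType (Fin j) L r k ∧
    @IsBasicBlockOf B (Fin j) _ L.toPartialOrder}

/-- Isomorphism of lattices. -/
def blockSetoid (B : Type*) [PartialOrder B] (j r k : ℕ) : Setoid (BlockOn B j r k) where
  r L M := Nonempty (@OrderIso (Fin j) (Fin j) L.1.toLE M.1.toLE)
  iseqv :=
    { refl := fun L => ⟨@OrderIso.refl (Fin j) L.1.toLE⟩
      symm := fun {L M} ⟨e⟩ => ⟨@OrderIso.symm (Fin j) (Fin j) L.1.toLE M.1.toLE e⟩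
      trans := fun {L M N} ⟨e⟩ ⟨f⟩ =>
        ⟨@OrderIso.trans (Fin j) (Fin j) (Fin j) L.1.toLE M.1.toLE N.1.toLE e f⟩ }

/-- The number, up to isomorphism, of blocks on `j` elements with `r` reducible elements, all
comparable, with nullity `k`, and with associated basic block `B`. -/
noncomputable def numBlocks (B : Type*) [PartialOrder B] (j r k : ℕ) : ℕ :=
  Nat.card (Quotient (blockSetoid B j r k))

/-- The number of partitions of `n` into exactly `k` positive parts. -/
def numPartitions (k n : ℕ) : ℕ :=
  (Finset.univ.filter fun p : n.Partition => Multiset.card p.parts = k).card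

/-- The basic block with elements `0, x, c₁, c₂, a, b, y, c₃, 1` and covering relations
`0 ⋖ x, c₁, c₂ ⋖ a ⋖ b ⋖ y, c₃ ⋖ 1`. -/
inductive B13 : Type
  | zero | x | c₁ | c₂ | a | b | y | c₃ | one

namespace B13

/-- The height of an element in the Hasse diagram. -/
def level : B13 → ℕ
  | zero => 0
  | x => 1
  | c₁ => 1
  | c₂ => 1
  | a => 2
  | b => 3
  | y => 4
  | c₃ => 4
  | one => 5

/-- Distinct elements are comparable exactly when their heights differ. -/
instance : PartialOrder B13 where
  le u v := u = v ∨ u.level < v.level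
  le_refl u := Or.inl rfl
  le_trans u v w := by
    rintro (rfl | h) (rfl | h')
    · exact Or.inl rfl
    · exact Or.inr h'
    · exact Or.inr h
    · exact Or.inr (h.trans h')
  le_antisymm u v := by
    rintro (rfl | h) (h' | h')
    · rfl
    · rfl
    · exact h'.symm
    · exact absurd (h.trans h') (lt_irrefl _)

end B13

/-- The dual of `B13`. -/
abbrev B14 : Type := B13ᵒᵈ

end LatticeCount

/-! The blocks with basic block `B13` are exactly the blow-ups of `B13`: posets obtained by
thickening every element other than `0`, `a`, `1` into a nonempty chain. A retractible element of
`IrrStar` subdivides an edge of the poset left after its removal (`exists_isSlot`), and no pendant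
element ever appears in a block or its retracts (`IsBranching.isBasicBlockOf_iff`), so everything
rests on edge subdivision. Subdividing an edge of a blow-up lengthens one of its chains
(`IsSlot.exists_isBlowup`); conversely a blow-up with a chain of length at least two can be
shortened (`IsBlowup.exists_isSlot`), ending at `B13`, which admits no further retraction.

Every blow-up is a lattice with four comparable reducible elements and nullity three
(`IsBlowup.isBlockOfType`), so those conditions cut out nothing more. Its isomorphism type amounts
to the multiset of the three lower chain sizes, the multiset of the two upper ones, and the size of
the middle chain: these data suffice (`IsBlowup.orderIso_of_sizes`) and can be read off the order
(`IsBlowup.sizes_unique`). With `r + 1` elements in the middle chain and `p` elements up to `a`, the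
lower sizes partition `p - 2` and the upper ones `j - p - r - 2`. The count for `B14` follows by
dualizing (`numBlocks_dual`). -/

namespace LatticeCount

set_option linter.constructorNameAsVariable false

/-! ### Retractible elements as edge subdivisions -/

section Slots

variable {P : Type*} [PartialOrder P]

/-- `x` subdivides the edge from `y` to `z`: it has the unique lower cover `y`, the unique upper
cover `z`, and nothing else lies strictly between `y` and `z`. -/
structure IsSlot (x y z : P) : Prop where
  lt_iff : ∀ w, w < x ↔ w ≤ y
  gt_iff : ∀ w, x < w ↔ z ≤ w
  between : ∀ w, y < w → w < z → w = x

theorem IsSlot.left_lt {x y z : P} (s : IsSlot x y z) : y < x := (s.lt_iff y).2 le_rfl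

theorem IsSlot.lt_right {x y z : P} (s : IsSlot x y z) : x < z := (s.gt_iff z).2 le_rfl

theorem IsSlot.left_lt_right {x y z : P} (s : IsSlot x y z) : y < z := s.left_lt.trans s.lt_right

theorem IsSlot.left_covBy {x y z : P} (s : IsSlot x y z) : y ⋖ x :=
  ⟨s.left_lt, fun w h h' => absurd ((s.lt_iff w).1 h') h.not_ge⟩

theorem IsSlot.covBy_right {x y z : P} (s : IsSlot x y z) : x ⋖ z :=
  ⟨s.lt_right, fun w h h' => absurd ((s.gt_iff w).1 h) h'.not_ge⟩

theorem IsSlot.eq_left {x y z w : P} (s : IsSlot x y z) (h : w ⋖ x) : w = y := by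
  rcases ((s.lt_iff w).1 h.lt).lt_or_eq with h' | h'
  · exact absurd s.left_lt (h.2 h')
  · exact h'

theorem IsSlot.eq_right {x y z w : P} (s : IsSlot x y z) (h : x ⋖ w) : w = z := by
  rcases ((s.gt_iff w).1 h.lt).lt_or_eq with h' | h'
  · exact absurd h' (h.2 s.lt_right)
  · exact h'.symm

theorem IsSlot.mem_irrStar {x y z : P} (s : IsSlot x y z) : x ∈ IrrStar P :=
  ⟨⟨y, s.left_covBy, fun _ h => s.eq_left h⟩, ⟨z, s.covBy_right, fun _ h => s.eq_right h⟩⟩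

theorem IsSlot.isRetractible {x y z : P} (s : IsSlot x y z) : IsRetractible x := by
  refine ⟨⟨fun u hu v hv => (s.eq_left hu).trans (s.eq_left hv).symm,
    fun u hu v hv => (s.eq_right hu).trans (s.eq_right hv).symm⟩, ?_⟩
  by_cases h : y ∈ Red P ∧ z ∈ Red P
  · exact Or.inr ⟨y, h.1, z, h.2, s.left_covBy, s.covBy_right, s.between⟩
  · refine Or.inl ?_
    rintro ⟨y', hy', z', hz', h1, h2⟩
    rw [s.eq_left h1] at hy'
    rw [s.eq_right h2] at hz'
    exact h ⟨hy', hz'⟩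

theorem lt_iff_le_of_covBy_unique [Finite P] {x y : P} (h : y ⋖ x) (hu : ∀ w, w ⋖ x → w = y)
    (w : P) : w < x ↔ w ≤ y := by
  refine ⟨fun hw => ?_, fun hw => hw.trans_lt h.lt⟩
  obtain ⟨c, hc, hcx⟩ := exists_le_covBy_of_lt hw
  exact hu c hcx ▸ hc

theorem lt_iff_le_of_covBy_unique' [Finite P] {x z : P} (h : x ⋖ z) (hu : ∀ w, x ⋖ w → w = z)
    (w : P) : x < w ↔ z ≤ w := by
  refine ⟨fun hw => ?_, fun hw => h.lt.trans_le hw⟩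
  obtain ⟨c, hxc, hc⟩ := exists_covBy_le_of_lt hw
  exact hu c hxc ▸ hc

/-- Both alternatives of retractibility leave only `x` between its neighbours. If one neighbour is
doubly irreducible, `x` is its only cover on that side, so whatever lies beyond that neighbour
already passes through `x`. -/
theorem exists_isSlot [Finite P] {x : P} (hx : x ∈ IrrStar P) (hr : IsRetractible x) :
    ∃ y z, IsSlot x y z := by
  obtain ⟨⟨y, hy, hyu⟩, ⟨z, hz, hzu⟩⟩ := hx
  have h1 := lt_iff_le_of_covBy_unique hy hyu
  have h2 := lt_iff_le_of_covBy_unique' hz hzu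
  refine ⟨y, z, h1, h2, fun w hyw hwz => ?_⟩
  rcases hr.2 with h | ⟨y', -, z', -, hy', hz', h⟩
  · have : y ∈ Irr P ∨ z ∈ Irr P := by
      by_contra! hc
      exact h ⟨y, hc.1, z, hc.2, hy, hz⟩
    rcases this with hi | hi
    · have h3 := lt_iff_le_of_covBy_unique' hy (fun w hw => hi.2 hw hy) w
      rcases (h3.1 hyw).lt_or_eq with h4 | h4
      · exact absurd ((h2 w).1 h4) hwz.not_ge
      · exact h4.symm
    · have h3 := lt_iff_le_of_covBy_unique hz (fun w hw => hi.1 hw hz) w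
      rcases (h3.1 hwz).lt_or_eq with h4 | h4
      · exact absurd ((h1 w).1 h4) hyw.not_ge
      · exact h4
  · rw [hyu y' hy', hzu z' hz'] at h
    exact h w hyw hwz

theorem retractStep_iff [Finite P] {S T : Set P} :
    RetractStep S T ↔ ∃ x y z : S, IsSlot x y z ∧ T = S \ {(x : P)} := by
  constructor
  · rintro ⟨x, hx, hr, h⟩
    obtain ⟨y, z, s⟩ := exists_isSlot hx hr
    exact ⟨x, y, z, s, h⟩
  · rintro ⟨x, y, z, s, h⟩
    exact ⟨x, s.mem_irrStar, s.isRetractible, h⟩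

theorem isBasicRetract_iff [Finite P] : IsBasicRetract P ↔ ∀ x y z : P, ¬ IsSlot x y z :=
  ⟨fun h x _ _ s => h x s.mem_irrStar s.isRetractible, fun h x hx hr => by
    obtain ⟨y, z, s⟩ := exists_isSlot hx hr
    exact h x y z s⟩

theorem IsSlot.map {Q : Type*} [PartialOrder Q] (e : P ≃o Q) {x y z : P} (s : IsSlot x y z) :
    IsSlot (e x) (e y) (e z) where
  lt_iff w := by
    rw [← e.apply_symm_apply w, e.lt_iff_lt, e.le_iff_le]
    exact s.lt_iff _
  gt_iff w := by
    rw [← e.apply_symm_apply w, e.lt_iff_lt, e.le_iff_le]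
    exact s.gt_iff _
  between w := by
    rw [← e.apply_symm_apply w, e.lt_iff_lt, e.lt_iff_lt]
    exact fun h1 h2 => congrArg e (s.between _ h1 h2)

end Slots

/-! ### Pendant elements never occur -/

section Branching

variable {P : Type*} [PartialOrder P]

/-- A bounded poset in which the least element does not have a unique upper cover and the greatest
element does not have a unique lower cover. -/
structure IsBranching (P : Type*) [PartialOrder P] : Prop where
  bot : ∃ o : P, IsBot o ∧ ¬ ∃ a, ∀ w, o < w ↔ a ≤ w
  top : ∃ t : P, IsTop t ∧ ¬ ∃ a, ∀ w, w < t ↔ w ≤ a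

/-- An element other than the bounds has a cover on each side; a bound with a single neighbour would
violate the branching condition. -/
theorem IsBranching.not_isPendant [Finite P] (hP : IsBranching P) (x : P) : ¬ IsPendant x := by
  obtain ⟨o, ho, ho'⟩ := hP.bot
  obtain ⟨t, ht, ht'⟩ := hP.top
  intro h
  obtain ⟨c, hc⟩ := Set.ncard_eq_one.1 h
  have key : ∀ w, (x ⋖ w ∨ w ⋖ x) ↔ w = c := fun w => by
    rw [← SimpleGraph.hasse_adj, ← SimpleGraph.mem_neighborSet, hc, Set.mem_singleton_iff]
  have up : ∀ w, x < w → x ⋖ c := fun w hw => by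
    obtain ⟨d, hd, -⟩ := exists_covBy_le_of_lt hw
    rwa [← (key d).1 (Or.inl hd)]
  have dn : ∀ w, w < x → c ⋖ x := fun w hw => by
    obtain ⟨d, -, hd⟩ := exists_le_covBy_of_lt hw
    rwa [← (key d).1 (Or.inr hd)]
  by_cases hxo : x = o
  · subst hxo
    rcases (key c).2 rfl with h1 | h1
    · exact ho' ⟨c, lt_iff_le_of_covBy_unique' h1 fun w hw => (key w).1 (Or.inl hw)⟩
    · exact absurd h1.lt (ho c).not_gt
  by_cases hxt : x = t
  · subst hxt
    rcases (key c).2 rfl with h1 | h1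
    · exact absurd h1.lt (ht c).not_gt
    · exact ht' ⟨c, lt_iff_le_of_covBy_unique h1 fun w hw => (key w).1 (Or.inr hw)⟩
  have h1 := up t ((ht x).lt_of_ne hxt)
  have h2 := dn o ((ho x).lt_of_ne (Ne.symm hxo))
  exact lt_asymm h1.lt h2.lt

theorem IsBranching.of_orderIso {Q : Type*} [PartialOrder Q] (hP : IsBranching P) (e : P ≃o Q) :
    IsBranching Q := by
  obtain ⟨o, ho, ho'⟩ := hP.bot
  obtain ⟨t, ht, ht'⟩ := hP.top
  refine ⟨⟨e o, fun w => ?_, fun ⟨a, ha⟩ => ho' ⟨e.symm a, fun w => ?_⟩⟩,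
    ⟨e t, fun w => ?_, fun ⟨a, ha⟩ => ht' ⟨e.symm a, fun w => ?_⟩⟩⟩
  · rw [← e.le_symm_apply]; exact ho _
  · rw [← e.lt_iff_lt, ha, e.symm_apply_le]
  · rw [← e.symm_apply_le]; exact ht _
  · rw [← e.lt_iff_lt, ha, e.le_symm_apply]

theorem IsBranching.retractStep [Finite P] {S T : Set P} (hS : IsBranching S)
    (h : RetractStep S T) : IsBranching T := by
  obtain ⟨x, y, z, s, rfl⟩ := retractStep_iff.1 h
  obtain ⟨o, ho, ho'⟩ := hS.bot
  obtain ⟨t, ht, ht'⟩ := hS.top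
  have mk : ∀ w : S, w ≠ x → (w : P) ∈ S \ {(x : P)} := fun w hw =>
    ⟨w.2, fun h => hw (Subtype.ext h)⟩
  have ne : ∀ w : ↥(S \ {(x : P)}), (⟨w.1, w.2.1⟩ : S) ≠ x := fun w h =>
    w.2.2 (congrArg Subtype.val h)
  have hox : o ≠ x := ((ho y).trans_lt s.left_lt).ne
  have htx : t ≠ x := (s.lt_right.trans_le (ht z)).ne'
  refine ⟨⟨⟨o, mk o hox⟩, fun w => ho ⟨w.1, w.2.1⟩, fun ⟨a, ha⟩ => ho' ?_⟩,
    ⟨⟨t, mk t htx⟩, fun w => ht ⟨w.1, w.2.1⟩, fun ⟨a, ha⟩ => ht' ?_⟩⟩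
  · have ha' : ∀ w : S, w ≠ x → (o < w ↔ (⟨a.1, a.2.1⟩ : S) ≤ w) := fun w hw => ha ⟨w.1, mk w hw⟩
    -- Suppose `a` is the least element above `o` after removal. If `y = o`, the slot forces `a =
    -- z`, so `x` was least above `o` before; otherwise `a ≤ y < x`, so `a` itself was.
    by_cases hy : y = o
    · subst hy
      refine ⟨x, fun w => ?_⟩
      have haz := (ha' z s.lt_right.ne').1 s.left_lt_right
      have hya := (ha' _ (ne a)).2 le_rfl
      have haz' : (⟨a.1, a.2.1⟩ : S) = z :=
        haz.eq_of_not_lt fun h => ne a (s.between _ hya h)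
      rw [haz'] at ha'
      by_cases hw : w = x
      · subst hw
        exact iff_of_true s.left_lt le_rfl
      · rw [ha' w hw, ← s.gt_iff]
        exact ⟨le_of_lt, fun h => h.lt_of_ne (Ne.symm hw)⟩
    · refine ⟨⟨a.1, a.2.1⟩, fun w => ?_⟩
      by_cases hw : w = x
      · subst hw
        exact iff_of_true ((ho _).lt_of_ne hox)
          (((ha' y s.left_lt.ne).1 ((ho y).lt_of_ne (Ne.symm hy))).trans s.left_lt.le)
      · exact ha' w hw
  · have ha' : ∀ w : S, w ≠ x → (w < t ↔ w ≤ (⟨a.1, a.2.1⟩ : S)) := fun w hw => ha ⟨w.1, mk w hw⟩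
    by_cases hz : z = t
    · subst hz
      refine ⟨x, fun w => ?_⟩
      have hay := (ha' y s.left_lt.ne).1 s.left_lt_right
      have haz := (ha' _ (ne a)).2 le_rfl
      have hay' : y = (⟨a.1, a.2.1⟩ : S) :=
        hay.eq_of_not_lt fun h => ne a (s.between _ h haz)
      rw [← hay'] at ha'
      by_cases hw : w = x
      · subst hw
        exact iff_of_true s.lt_right le_rfl
      · rw [ha' w hw, ← s.lt_iff]
        exact ⟨le_of_lt, fun h => h.lt_of_ne hw⟩
    · refine ⟨⟨a.1, a.2.1⟩, fun w => ?_⟩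
      by_cases hw : w = x
      · subst hw
        exact iff_of_true ((ht _).lt_of_ne (Ne.symm htx))
          (s.lt_right.le.trans ((ha' z s.lt_right.ne').1 ((ht z).lt_of_ne hz)))
      · exact ha' w hw

theorem IsBlock.isBranching {L : Type*} [Lattice L] (h : IsBlock L) : IsBranching L := by
  obtain ⟨⟨o, ho, u, v, hu, hv, huv⟩, ⟨t, ht, u', v', hu', hv', huv'⟩⟩ := h
  refine ⟨⟨o, ho, fun ⟨a, ha⟩ => ?_⟩, ⟨t, ht, fun ⟨a, ha⟩ => ?_⟩⟩
  · have h1 := (ha u).1 ((ho u).lt_of_ne hu.symm)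
    have h2 := (ha v).1 ((ho v).lt_of_ne hv.symm)
    exact ((ha a).2 le_rfl).not_ge (huv ▸ le_inf h1 h2)
  · have h1 := (ha u').1 ((ht u').lt_of_ne hu')
    have h2 := (ha v').1 ((ht v').lt_of_ne hv')
    exact ((ha a).2 le_rfl).not_ge (huv' ▸ sup_le h1 h2)

/-- Branching survives every retraction step, so the stage that removes pendant elements is empty.
-/
theorem IsBranching.isBasicBlockOf_iff {B : Type*} [PartialOrder B] [Finite P]
    (hP : IsBranching P) :
    IsBasicBlockOf B P ↔ ∃ R : Set P, Relation.ReflTransGen RetractStep Set.univ R ∧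
      IsBasicRetract R ∧ Nonempty (B ≃o R) := by
  have key : ∀ R : Set P, Relation.ReflTransGen RetractStep Set.univ R → IsBranching R := by
    intro R hR
    induction hR with
    | refl => exact hP.of_orderIso OrderIso.Set.univ.symm
    | tail _ h ih => exact ih.retractStep h
  constructor
  · rintro ⟨R, S, hR, hb, hS, -, hB⟩
    rcases hS.cases_head with rfl | ⟨T, ⟨x, hx, -⟩, -⟩
    · exact ⟨R, hR, hb, hB⟩
    · exact absurd hx ((key R hR).not_isPendant x)
  · rintro ⟨R, hR, hb, hB⟩
    exact ⟨R, R, hR, hb, .refl, (key R hR).not_isPendant, hB⟩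

end Branching

/-! ### Blow-ups of `B13` -/

/-- `h` exhibits `P` as obtained from `B13` by replacing each element by a nonempty finite chain,
where `0`, `a` and `1` are replaced by single elements. -/
structure IsBlowup {P : Type*} [PartialOrder P] (h : P → B13) : Prop where
  level_lt_or_eq : ∀ {u v}, u ≤ v → (h u).level < (h v).level ∨ h u = h v
  lt_of_level_lt : ∀ {u v}, (h u).level < (h v).level → u < v
  le_total : ∀ {u v}, h u = h v → u ≤ v ∨ v ≤ u
  surjective : Function.Surjective h
  eq_of_single : ∀ {u v}, h u = h v → h u = .zero ∨ h u = .a ∨ h u = .one → u = v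

namespace IsBlowup

variable {P : Type*} [PartialOrder P] {h : P → B13}

theorem level_le (H : IsBlowup h) {u v : P} (huv : u ≤ v) : (h u).level ≤ (h v).level := by
  rcases H.level_lt_or_eq huv with h1 | h1
  · exact h1.le
  · rw [h1]

theorem exists_level (H : IsBlowup h) {k : ℕ} (hk : k ≤ 5) : ∃ u, (h u).level = k := by
  obtain ⟨b, hb⟩ : ∃ b : B13, b.level = k := by
    interval_cases k
    exacts [⟨.zero, rfl⟩, ⟨.x, rfl⟩, ⟨.a, rfl⟩, ⟨.b, rfl⟩, ⟨.y, rfl⟩, ⟨.one, rfl⟩]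
  obtain ⟨u, hu⟩ := H.surjective b
  exact ⟨u, hu ▸ hb⟩

/-- If nothing lies between `y < z`, then their labels agree or are on consecutive levels. -/
theorem eq_or_level_succ (H : IsBlowup h) {y z : P} (hyz : y < z)
    (hmid : ∀ w, y < w → ¬ w < z) : h y = h z ∨ (h y).level + 1 = (h z).level := by
  rcases H.level_lt_or_eq hyz.le with h1 | h1
  · right
    by_contra hne
    have h2 : (h z).level ≤ 5 := by cases h z <;> decide
    obtain ⟨w, hw⟩ := H.exists_level (k := (h y).level + 1) (by omega)
    exact hmid w (H.lt_of_level_lt (by omega)) (H.lt_of_level_lt (by omega))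
  · exact Or.inl h1

theorem comp_orderIso (H : IsBlowup h) {Q : Type*} [PartialOrder Q] (e : Q ≃o P) :
    IsBlowup (h ∘ e) where
  level_lt_or_eq huv := H.level_lt_or_eq (e.le_iff_le.2 huv)
  lt_of_level_lt huv := e.lt_iff_lt.1 (H.lt_of_level_lt huv)
  le_total huv := by simpa using H.le_total huv
  surjective := H.surjective.comp e.surjective
  eq_of_single h1 h2 := e.injective (H.eq_of_single h1 h2)

theorem id : IsBlowup (fun b : B13 => b) where
  level_lt_or_eq h := h.symm
  lt_of_level_lt h := lt_of_le_of_ne (Or.inr h) fun h' => by simp [h'] at h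
  le_total h := Or.inl (Or.inl h)
  surjective b := ⟨b, rfl⟩
  eq_of_single h _ := h

end IsBlowup

/-- Levels 0, 2, 3, 5 carry one label each, while level 1 carries three and level 4 two. This turns
most comparisons of labels into arithmetic on levels. -/
theorem B13.eq_of_level_eq {u v : B13} (h : u.level = v.level)
    (hu : u.level = 0 ∨ u.level = 2 ∨ u.level = 3 ∨ u.level = 5) : u = v := by
  cases u <;> cases v <;> simp_all [B13.level]

theorem B13.single_iff {u : B13} :
    (u = .zero ∨ u = .a ∨ u = .one) ↔ u.level = 0 ∨ u.level = 2 ∨ u.level = 5 := by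
  cases u <;> simp [B13.level]

theorem B13.level_le_five (u : B13) : u.level ≤ 5 := by cases u <;> decide

theorem IsBlowup.exists_greatest_level {P : Type*} [PartialOrder P] [Finite P] {h : P → B13}
    (H : IsBlowup h) {k : ℕ}
    (hk : k = 0 ∨ k = 2 ∨ k = 3 ∨ k = 5) :
    ∃ y, (h y).level = k ∧ ∀ w, (h w).level = k → w ≤ y := by
  obtain ⟨u, hu⟩ := H.exists_level (k := k) (by omega)
  obtain ⟨y, hy⟩ := (Set.toFinite {w | (h w).level = k}).exists_maximal ⟨u, hu⟩
  refine ⟨y, hy.1, fun w hw => ?_⟩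
  have hyk : (h y).level = k := hy.1
  rcases H.le_total (B13.eq_of_level_eq (hyk.trans hw.symm) (by omega)) with h1 | h1
  exacts [hy.2 hw h1, h1]

/-! ### Subdividing an edge of a blow-up -/

section Insert

variable {P : Type*} [PartialOrder P]

/-- A blow-up structure extends over a slot once the label of the new element is suitable. -/
theorem IsBlowup.extend {x y z : P} (s : IsSlot x y z) {h : {w // w ≠ x} → B13}
    (H : IsBlowup h) (l : B13) (hl : ¬ (l = .zero ∨ l = .a ∨ l = .one))
    (h1 : ∀ w : {w // w ≠ x}, (w : P) ≤ y → (h w).level < l.level ∨ h w = l)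
    (h2 : ∀ w : {w // w ≠ x}, z ≤ (w : P) → l.level < (h w).level ∨ h w = l)
    (h3 : ∀ w : {w // w ≠ x}, (h w).level < l.level → (w : P) ≤ y)
    (h4 : ∀ w : {w // w ≠ x}, l.level < (h w).level → z ≤ (w : P))
    (h5 : ∀ w : {w // w ≠ x}, h w = l → (w : P) ≤ y ∨ z ≤ (w : P)) :
    ∃ h : P → B13, IsBlowup h := by
  classical
  let g : P → B13 := fun w => if hw : w = x then l else h ⟨w, hw⟩
  have gx : g x = l := by simp [g]
  have gw : ∀ w (hw : w ≠ x), g w = h ⟨w, hw⟩ := fun w hw => by simp [g, hw]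
  refine ⟨g, ?_, ?_, ?_, ?_, ?_⟩
  · intro u v huv
    by_cases hu : u = x <;> by_cases hv : v = x
    · rw [hu, hv]; exact Or.inr rfl
    · subst hu
      rw [gx, gw v hv]
      rcases h2 ⟨v, hv⟩ ((s.gt_iff v).1 (huv.lt_of_ne (Ne.symm hv))) with h' | h'
      exacts [Or.inl h', Or.inr h'.symm]
    · subst hv
      rw [gx, gw u hu]
      exact h1 ⟨u, hu⟩ ((s.lt_iff u).1 (huv.lt_of_ne hu))
    · rw [gw u hu, gw v hv]
      exact H.level_lt_or_eq (u := ⟨u, hu⟩) (v := ⟨v, hv⟩) huv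
  · intro u v huv
    by_cases hu : u = x <;> by_cases hv : v = x
    · rw [hu, hv] at huv; exact absurd huv (lt_irrefl _)
    · subst hu
      rw [gx, gw v hv] at huv
      exact (s.gt_iff v).2 (h4 _ huv)
    · subst hv
      rw [gx, gw u hu] at huv
      exact (s.lt_iff u).2 (h3 _ huv)
    · rw [gw u hu, gw v hv] at huv
      exact H.lt_of_level_lt huv
  · intro u v huv
    by_cases hu : u = x <;> by_cases hv : v = x
    · rw [hu, hv]; exact Or.inl le_rfl
    · subst hu
      rw [gx, gw v hv] at huv
      rcases h5 _ huv.symm with h' | h'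
      · exact Or.inr ((s.lt_iff v).2 h').le
      · exact Or.inl ((s.gt_iff v).2 h').le
    · subst hv
      rw [gx, gw u hu] at huv
      rcases h5 _ huv with h' | h'
      · exact Or.inl ((s.lt_iff u).2 h').le
      · exact Or.inr ((s.gt_iff u).2 h').le
    · rw [gw u hu, gw v hv] at huv
      exact H.le_total huv
  · intro b
    obtain ⟨w, hw⟩ := H.surjective b
    exact ⟨w, by rw [gw w w.2]; exact hw⟩
  · intro u v huv hs
    by_cases hu : u = x <;> by_cases hv : v = x
    · rw [hu, hv]
    · subst hu
      rw [gx] at hs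
      exact absurd hs hl
    · subst hv
      rw [huv, gx] at hs
      exact absurd hs hl
    · rw [gw u hu, gw v hv] at huv
      rw [gw u hu] at hs
      exact congrArg Subtype.val (H.eq_of_single huv hs)

/-- The new element must take a label whose chain may grow. If the label of `z` is `0`, `a` or `1`,
then `y` sits one level lower, at level 1 or 4, so its chain may grow. -/
theorem IsSlot.exists_isBlowup {x y z : P} (s : IsSlot x y z) {h : {w // w ≠ x} → B13}
    (H : IsBlowup h) : ∃ h : P → B13, IsBlowup h := by
  set Y : {w // w ≠ x} := ⟨y, s.left_lt.ne⟩ with hY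
  set Z : {w // w ≠ x} := ⟨z, s.lt_right.ne'⟩ with hZ
  have hYZ : Y < Z := s.left_lt_right
  have hmid : ∀ w, Y < w → ¬ w < Z := fun w h1 h2 => w.2 (s.between w h1 h2)
  have hlev := H.eq_or_level_succ hYZ hmid
  by_cases hz : (h Z).level = 0 ∨ (h Z).level = 2 ∨ (h Z).level = 5
  · -- the new element joins the chain of `y`
    have hYZl : (h Y).level + 1 = (h Z).level := by
      rcases hlev with h1 | h1
      · exact absurd (H.eq_of_single h1 (B13.single_iff.2 (h1 ▸ hz))) hYZ.ne
      · exact h1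
    refine H.extend s (h Y) (fun hc => ?_) (fun w hw => H.level_lt_or_eq (v := Y) hw)
      (fun w hw => Or.inl ?_) (fun w hw => (H.lt_of_level_lt (v := Y) hw).le) (fun w hw => ?_)
      (fun w hw => ?_)
    · have := B13.single_iff.1 hc
      omega
    · have := H.level_le (u := Z) (v := w) hw
      omega
    · rcases (show (h Z).level ≤ (h w).level by omega).lt_or_eq with h1 | h1
      · exact (H.lt_of_level_lt (u := Z) (v := w) h1).le
      · have h2 := B13.eq_of_level_eq h1 (by omega)
        exact (congrArg Subtype.val (H.eq_of_single h2 (B13.single_iff.2 hz))).le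
    · have hwZ : w < Z := H.lt_of_level_lt (by rw [hw]; omega)
      rcases H.le_total hw with h1 | h1
      · exact Or.inl h1
      · rcases h1.lt_or_eq with h1 | h1
        · exact absurd hwZ (hmid w h1)
        · exact Or.inl (congrArg Subtype.val h1).ge
  · -- the new element joins the chain of `z`
    have hz5 := (h Z).level_le_five
    refine H.extend s (h Z) (fun hc => hz (B13.single_iff.1 hc)) (fun w hw => ?_)
      (fun w hw => ?_) (fun w hw => ?_) (fun w hw => (H.lt_of_level_lt (u := Z) hw).le)
      (fun w hw => ?_)
    · exact H.level_lt_or_eq (u := w) (v := Z) (le_trans (b := Y) hw hYZ.le)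
    · rcases H.level_lt_or_eq (u := Z) (v := w) hw with h1 | h1
      exacts [Or.inl h1, Or.inr h1.symm]
    · have hwZ : w < Z := H.lt_of_level_lt hw
      rcases hlev with h1 | h1
      · exact (H.lt_of_level_lt (u := w) (v := Y) (h1 ▸ hw)).le
      · rcases (show (h w).level ≤ (h Y).level by omega).lt_or_eq with h2 | h2
        · exact (H.lt_of_level_lt (u := w) (v := Y) h2).le
        · have h3 := B13.eq_of_level_eq h2 (by omega)
          rcases H.le_total h3 with h4 | h4
          · exact h4
          · rcases h4.lt_or_eq with h4 | h4
            · exact absurd hwZ (hmid w h4)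
            · exact (congrArg Subtype.val h4).ge
    · rcases H.le_total hw with h1 | h1
      · rcases h1.lt_or_eq with h1 | h1
        · left
          have h3 : w ≤ Y ∨ Y ≤ w := by
            rcases hlev with h2 | h2
            · exact H.le_total (hw.trans h2.symm)
            · exact Or.inr (H.lt_of_level_lt (by rw [hw]; omega)).le
          rcases h3 with h3 | h3
          · exact h3
          · rcases h3.lt_or_eq with h4 | h4
            · exact absurd h1 (hmid w h4)
            · exact (congrArg Subtype.val h4).ge
        · exact Or.inr (congrArg Subtype.val h1).ge
      · exact Or.inr h1

/-- Removing one element from a subposet. -/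
def sdiffSingletonIso {S : Set P} (x : S) : {w : S // w ≠ x} ≃o ↥(S \ {(x : P)}) where
  toFun w := ⟨w.1.1, w.1.2, fun h => w.2 (Subtype.ext h)⟩
  invFun w := ⟨⟨w.1, w.2.1⟩, fun h => w.2.2 (congrArg Subtype.val h)⟩
  left_inv _ := rfl
  right_inv _ := rfl
  map_rel_iff' := Iff.rfl

theorem exists_isBlowup_of_retractStep [Finite P] {S T : Set P} (hST : RetractStep S T)
    (hT : ∃ h : T → B13, IsBlowup h) : ∃ h : S → B13, IsBlowup h := by
  obtain ⟨x, y, z, s, rfl⟩ := retractStep_iff.1 hST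
  obtain ⟨h, H⟩ := hT
  exact s.exists_isBlowup (H.comp_orderIso (sdiffSingletonIso x))

/-- The labelling is built backwards along the retraction, starting from the isomorphism of the
final retract with `B13`. -/
theorem IsBranching.exists_isBlowup [Finite P] (hP : IsBranching P) (hB : IsBasicBlockOf B13 P) :
    ∃ h : P → B13, IsBlowup h := by
  obtain ⟨R, hR, -, ⟨e⟩⟩ := hP.isBasicBlockOf_iff.1 hB
  have : ∀ S, Relation.ReflTransGen RetractStep S R → ∃ h : S → B13, IsBlowup h := by
    intro S hS
    induction hS using Relation.ReflTransGen.head_induction_on with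
    | refl => exact ⟨_, IsBlowup.id.comp_orderIso e.symm⟩
    | head h _ ih => exact exists_isBlowup_of_retractStep h ih
  obtain ⟨h, H⟩ := this _ hR
  exact ⟨_, H.comp_orderIso OrderIso.Set.univ.symm⟩

end Insert

/-! ### Retracting a blow-up to `B13` -/

section Retract

variable {P : Type*} [PartialOrder P]

/-- A non-injective blow-up contains a slot whose removal leaves a blow-up. -/
theorem IsBlowup.exists_isSlot [Finite P] {h : P → B13} (H : IsBlowup h)
    (hinj : ¬ Function.Injective h) :
    ∃ x y z : P, IsSlot x y z ∧ IsBlowup (fun w : {w // w ≠ x} => h w) := by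
  have : ∃ p q : P, p < q ∧ h p = h q := by
    simp only [Function.Injective, not_forall] at hinj
    obtain ⟨p, q, hpq, hne⟩ := hinj
    rcases H.le_total hpq with h1 | h1
    · exact ⟨p, q, h1.lt_of_ne hne, hpq⟩
    · exact ⟨q, p, h1.lt_of_ne (Ne.symm hne), hpq.symm⟩
  obtain ⟨p, q, hpq, hl⟩ := this
  set l := h p with hlp
  obtain ⟨x, hxl, hx⟩ : ∃ x, h x = l ∧ ∀ w, h w = l → x ≤ w := by
    obtain ⟨x, hx⟩ := (Set.toFinite {w | h w = l}).exists_minimal ⟨p, rfl⟩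
    refine ⟨x, hx.1, fun w hw => ?_⟩
    rcases H.le_total (hx.1.trans hw.symm) with h1 | h1
    exacts [h1, hx.2 hw h1]
  have hxq : x < q := (hx p rfl).trans_lt hpq
  obtain ⟨z, ⟨hzl, hxz⟩, hz⟩ : ∃ z, (h z = l ∧ x < z) ∧ ∀ w, h w = l → x < w → z ≤ w := by
    obtain ⟨x, hx⟩ := (Set.toFinite {w | h w = l ∧ x < w}).exists_minimal ⟨q, hl.symm, hxq⟩
    refine ⟨x, hx.1, fun w hw hw' => ?_⟩
    rcases H.le_total (hx.1.1.trans hw.symm) with h1 | h1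
    exacts [h1, hx.2 ⟨hw, hw'⟩ h1]
  have hsingle : ¬ (l = .zero ∨ l = .a ∨ l = .one) := fun hc => hpq.ne (H.eq_of_single hl hc)
  -- A chain that can be shortened has level 1, 3 or 4, and the level below carries one label. The
  -- greatest element `y` there is thus the only lower cover of the least element `x` of the chain;
  -- `z` is the next element of the chain.
  have hlev : ∃ k, (k = 0 ∨ k = 2 ∨ k = 3) ∧ l.level = k + 1 := by
    revert hsingle
    cases l <;> simp [B13.level]
  obtain ⟨k, hk, hlk⟩ := hlev
  obtain ⟨y, hyk, hy⟩ := H.exists_greatest_level (k := k) (by omega)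
  refine ⟨x, y, z, ⟨fun w => ⟨fun hw => ?_, fun hw => ?_⟩, fun w => ⟨fun hw => ?_, fun hw => ?_⟩,
    fun w hw hw' => ?_⟩, ?_, ?_, ?_, ?_, ?_⟩
  · rcases H.level_lt_or_eq hw.le with h1 | h1
    · rw [hxl, hlk] at h1
      rcases (Nat.lt_succ_iff.1 h1).lt_or_eq with h2 | h2
      · exact (H.lt_of_level_lt (by omega)).le
      · exact hy w h2
    · exact absurd (hx w (h1.trans hxl)) hw.not_ge
  · exact H.lt_of_level_lt (by have := H.level_le hw; rw [hxl]; omega)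
  · rcases H.level_lt_or_eq hw.le with h1 | h1
    · exact (H.lt_of_level_lt (by rw [hzl, ← hxl]; exact h1)).le
    · exact hz w (h1.symm.trans hxl) hw
  · exact hxz.trans_le hw
  · rcases H.level_lt_or_eq hw'.le with h1 | h1
    · have h2 := H.level_le hw.le
      rw [hzl] at h1
      exact absurd (hy w (by omega)) hw.not_ge
    · by_contra hne
      have h2 := hx w (h1.trans hzl)
      exact absurd (hz w (h1.trans hzl) (h2.lt_of_ne (Ne.symm hne))) hw'.not_ge
  · exact fun h1 => H.level_lt_or_eq h1
  · exact fun h1 => H.lt_of_level_lt h1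
  · exact fun h1 => H.le_total h1
  · intro b
    obtain ⟨w, hw⟩ := H.surjective b
    by_cases hwx : w = x
    · exact ⟨⟨z, hxz.ne'⟩, by rw [← hw, hwx]; exact hzl.trans hxl.symm⟩
    · exact ⟨⟨w, hwx⟩, hw⟩
  · exact fun h1 h2 => Subtype.ext (H.eq_of_single h1 h2)

/-- At levels 1 and 4 another element lies between the same neighbours; `a` has several lower
covers, `b` several upper ones, and the bounds lack a neighbour on one side. -/
theorem B13.not_isSlot (x y z : B13) : ¬ IsSlot x y z := by
  intro s
  have hxy := (IsBlowup.id).eq_or_level_succ s.left_covBy.lt fun w h => s.left_covBy.2 h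
  have hxz := (IsBlowup.id).eq_or_level_succ s.covBy_right.lt fun w h => s.covBy_right.2 h
  have h2 : y.level + 1 = x.level := hxy.resolve_left s.left_lt.ne
  have h3 : x.level + 1 = z.level := hxz.resolve_left s.lt_right.ne
  have lt : ∀ {u v : B13}, u.level < v.level → u < v := IsBlowup.id.lt_of_level_lt
  have mid : ∀ w : B13, w.level = x.level → w = x := fun w hw =>
    s.between w (lt (by omega)) (lt (by omega))
  have dn : ∀ w : B13, w.level < x.level → w ≤ y := fun w hw => (s.lt_iff w).1 (lt hw)
  have up : ∀ w : B13, x.level < w.level → z ≤ w := fun w hw => (s.gt_iff w).1 (lt hw)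
  have le : ∀ {u v : B13}, u ≤ v → u = v ∨ u.level < v.level := fun h => h
  cases x
  case zero => simp [B13.level] at h2
  case x => exact absurd (mid .c₁ rfl) (by simp)
  case c₁ => exact absurd (mid .c₂ rfl) (by simp)
  case c₂ => exact absurd (mid .c₁ rfl) (by simp)
  case a =>
    have e1 := le (dn .x (by decide))
    have e2 := le (dn .c₁ (by decide))
    simp only [B13.level] at h2 e1 e2
    have e1 := e1.resolve_right (by omega)
    have e2 := e2.resolve_right (by omega)
    exact absurd (e1.trans e2.symm) (by simp)
  case b =>
    have e1 := le (up .y (by decide))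
    have e2 := le (up .c₃ (by decide))
    simp only [B13.level] at h3 e1 e2
    have e1 := e1.resolve_right (by omega)
    have e2 := e2.resolve_right (by omega)
    exact absurd (e1.symm.trans e2) (by simp)
  case y => exact absurd (mid .c₃ rfl) (by simp)
  case c₃ => exact absurd (mid .y rfl) (by simp)
  case one =>
    have := z.level_le_five
    simp only [B13.level] at h3 this
    omega

theorem IsBlowup.exists_orderIso {h : P → B13} (H : IsBlowup h)
    (hinj : Function.Injective h) : Nonempty (B13 ≃o P) := by
  refine ⟨OrderIso.symm ⟨Equiv.ofBijective h ⟨hinj, H.surjective⟩, ?_⟩⟩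
  intro u v
  refine ⟨?_, fun h1 => (H.level_lt_or_eq h1).symm⟩
  rintro (h1 | h1)
  · exact (hinj h1).le
  · exact (H.lt_of_level_lt h1).le

/-- Chains are shortened until the labelling is injective, by induction on the number of elements.
-/
theorem IsBlowup.exists_retract [Finite P] (n : ℕ) : ∀ {S : Set P}, S.ncard = n →
    ∀ {h : S → B13}, IsBlowup h → ∃ R : Set P, Relation.ReflTransGen RetractStep S R ∧
      Nonempty (B13 ≃o R) := by
  induction n with
  | zero =>
    intro S hS h H
    obtain ⟨u, -⟩ := H.surjective .zero
    rw [Set.ncard_eq_zero] at hS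
    exact absurd u.2 (by simp [hS])
  | succ n ih =>
    intro S hS h H
    by_cases hinj : Function.Injective h
    · exact ⟨S, .refl, H.exists_orderIso hinj⟩
    · obtain ⟨x, y, z, s, H'⟩ := H.exists_isSlot hinj
      have hc : (S \ {(x : P)}).ncard = n := by
        rw [Set.ncard_sdiff_singleton_of_mem x.2, hS, Nat.add_sub_cancel]
      obtain ⟨R, hR, hB⟩ := ih hc (H'.comp_orderIso (sdiffSingletonIso x).symm)
      exact ⟨R, .head (retractStep_iff.2 ⟨x, y, z, s, rfl⟩) hR, hB⟩

theorem IsBlowup.isBasicBlockOf [Finite P] {h : P → B13} (H : IsBlowup h)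
    (hP : IsBranching P) : IsBasicBlockOf B13 P := by
  obtain ⟨R, hR, ⟨e⟩⟩ := IsBlowup.exists_retract _ rfl (H.comp_orderIso OrderIso.Set.univ)
  exact hP.isBasicBlockOf_iff.2 ⟨R, hR, isBasicRetract_iff.2 fun x y z s =>
    B13.not_isSlot _ _ _ (s.map e.symm), ⟨e⟩⟩

end Retract

/-! ### Cover graphs and reducible elements -/

section Nullity

variable {P : Type*} [PartialOrder P]

/-- Each edge is counted at its upper end. -/
theorem ncard_edgeSet_hasse [Fintype P] :
    (SimpleGraph.hasse P).edgeSet.ncard = ∑ u : P, {y | y ⋖ u}.ncard := by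
  have h1 : (SimpleGraph.hasse P).edgeSet =
      (fun p : P × P => s(p.1, p.2)) '' {p | p.1 ⋖ p.2} := by
    ext e
    induction e using Sym2.ind with
    | _ u v =>
      simp only [SimpleGraph.mem_edgeSet, SimpleGraph.hasse_adj, Set.mem_image, Set.mem_ofPred_eq,
        Prod.exists]
      constructor
      · rintro (h | h)
        exacts [⟨u, v, h, rfl⟩, ⟨v, u, h, Sym2.eq_swap⟩]
      · rintro ⟨p, q, h, he⟩
        rcases Sym2.eq_iff.1 he with ⟨rfl, rfl⟩ | ⟨rfl, rfl⟩
        exacts [Or.inl h, Or.inr h]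
  have h2 : Set.InjOn (fun p : P × P => s(p.1, p.2)) {p | p.1 ⋖ p.2} := by
    rintro ⟨p, q⟩ h ⟨p', q'⟩ h' he
    rcases Sym2.eq_iff.1 he with ⟨rfl, rfl⟩ | ⟨rfl, rfl⟩
    · rfl
    · exact absurd (CovBy.lt h) (CovBy.lt h').asymm
  rw [h1, h2.ncard_image]
  simp_rw [← Nat.card_coe_set_eq]
  rw [← Nat.card_sigma]
  exact Nat.card_congr
    { toFun := fun p => ⟨p.1.2, p.1.1, p.2⟩
      invFun := fun p => ⟨(p.2.1, p.1), p.2.2⟩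
      left_inv := fun _ => rfl
      right_inv := fun _ => rfl }

theorem card_connectedComponent_hasse [Finite P] {o : P} (ho : IsBot o) :
    Nat.card (SimpleGraph.hasse P).ConnectedComponent = 1 := by
  have key : ∀ u, (SimpleGraph.hasse P).Reachable u o := by
    intro u
    induction u using WellFoundedLT.induction with
    | ind u ih =>
      by_cases hu : u = o
      · rw [hu]
      · obtain ⟨c, -, hc⟩ := exists_le_covBy_of_lt ((ho u).lt_of_ne (Ne.symm hu))
        exact .trans (SimpleGraph.Adj.reachable (Or.inr hc)) (ih c hc.lt)
  have : Subsingleton (SimpleGraph.hasse P).ConnectedComponent :=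
    SimpleGraph.Preconnected.subsingleton_connectedComponent fun u v => (key u).trans (key v).symm
  have : Nonempty (SimpleGraph.hasse P).ConnectedComponent :=
    ⟨(SimpleGraph.hasse P).connectedComponentMk o⟩
  exact Nat.card_unique

end Nullity

section Reducible

variable {L : Type*} [Lattice L] [Finite L]

/-- If there were only one lower cover, both joinands would lie below it, and so would their join.
-/
theorem JoinReducible.not_subsingleton {u : L} (h : JoinReducible u) :
    ¬ {c | c ⋖ u}.Subsingleton := by
  obtain ⟨p, q, hp, hq, rfl⟩ := h
  intro hs
  obtain ⟨c, hpc, hc⟩ := exists_le_covBy_of_lt (le_sup_left.lt_of_ne hp)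
  obtain ⟨d, hqd, hd⟩ := exists_le_covBy_of_lt (le_sup_right.lt_of_ne hq)
  exact hc.lt.not_ge (sup_le hpc (hs hc hd ▸ hqd))

theorem MeetReducible.not_subsingleton {u : L} (h : MeetReducible u) :
    ¬ {c | u ⋖ c}.Subsingleton := by
  obtain ⟨p, q, hp, hq, rfl⟩ := h
  intro hs
  obtain ⟨c, hc, hpc⟩ := exists_covBy_le_of_lt (inf_le_left.lt_of_ne hp.symm)
  obtain ⟨d, hd, hqd⟩ := exists_covBy_le_of_lt (inf_le_right.lt_of_ne hq.symm)
  exact hc.lt.not_ge (le_inf hpc (hs hc hd ▸ hqd))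

end Reducible

/-! ### Blow-ups are blocks of the required type -/

namespace IsBlowup

variable {P : Type*} [PartialOrder P] {h : P → B13}

theorem exists_bot (H : IsBlowup h) : ∃ o, h o = .zero ∧ IsBot o := by
  obtain ⟨o, ho⟩ := H.surjective .zero
  refine ⟨o, ho, fun w => ?_⟩
  rcases Nat.eq_zero_or_pos (h w).level with h1 | h1
  · have h2 : h o = h w := B13.eq_of_level_eq (by rw [ho, h1]; rfl) (by rw [ho]; simp [B13.level])
    exact (H.eq_of_single h2 (Or.inl ho)).le
  · exact (H.lt_of_level_lt (by rw [ho]; exact h1)).le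

theorem exists_top (H : IsBlowup h) : ∃ t, h t = .one ∧ IsTop t := by
  obtain ⟨t, ht⟩ := H.surjective .one
  refine ⟨t, ht, fun w => ?_⟩
  rcases (h w).level_le_five.lt_or_eq with h1 | h1
  · exact (H.lt_of_level_lt (by rw [ht]; exact h1)).le
  · have h2 : h t = h w := B13.eq_of_level_eq (by rw [ht, h1]; rfl) (by rw [ht]; simp [B13.level])
    exact (H.eq_of_single h2 (Or.inr (Or.inr ht))).ge

theorem level_lt_of_le_of_le (H : IsBlowup h) {p q w : P} (hpq : (h p).level = (h q).level)
    (hne : h p ≠ h q) (hp : w ≤ p) (hq : w ≤ q) : (h w).level < (h p).level := by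
  rcases H.level_lt_or_eq hp with h1 | h1
  · exact h1
  · rcases H.level_lt_or_eq hq with h2 | h2
    exacts [hpq ▸ h2, absurd (h1.symm.trans h2) hne]

theorem lt_level_of_le_of_le (H : IsBlowup h) {p q w : P} (hpq : (h p).level = (h q).level)
    (hne : h p ≠ h q) (hp : p ≤ w) (hq : q ≤ w) : (h p).level < (h w).level := by
  rcases H.level_lt_or_eq hp with h1 | h1
  · exact h1
  · rcases H.level_lt_or_eq hq with h2 | h2
    exacts [hpq ▸ h2, absurd (h1.trans h2.symm) hne]

theorem incomparable (H : IsBlowup h) {u v : P} (huv : ¬ u ≤ v) (hvu : ¬ v ≤ u) :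
    h u ≠ h v ∧ (h u).level = (h v).level ∧ ((h u).level = 1 ∨ (h u).level = 4) := by
  have hne : h u ≠ h v := fun he => (H.le_total he).elim huv hvu
  have hl : (h u).level = (h v).level := by
    by_contra hc
    rcases Nat.lt_or_gt_of_ne hc with h1 | h1
    exacts [huv (H.lt_of_level_lt h1).le, hvu (H.lt_of_level_lt h1).le]
  refine ⟨hne, hl, ?_⟩
  by_contra hc
  have := (h u).level_le_five
  exact hne (B13.eq_of_level_eq hl (by omega))

/-- Incomparable elements lie in different chains of level 1 or 4. Their common upper bounds lie on
higher levels, and the next level, 2 or 5, has a single element. -/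
theorem exists_isLUB (H : IsBlowup h) (u v : P) : ∃ m, IsLUB {u, v} m := by
  by_cases huv : u ≤ v
  · exact ⟨v, by simp [huv], fun w hw => hw (by simp)⟩
  by_cases hvu : v ≤ u
  · exact ⟨u, by simp [hvu], fun w hw => hw (by simp)⟩
  obtain ⟨hne, hl, h1⟩ := H.incomparable huv hvu
  obtain ⟨m, hm⟩ := H.exists_level (k := (h u).level + 1) (by omega)
  refine ⟨m, ?_, fun w hw => ?_⟩
  · rintro w (rfl | rfl) <;> exact (H.lt_of_level_lt (by omega)).le
  · have h2 := H.lt_level_of_le_of_le hl hne (hw (by simp)) (hw (by simp))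
    rcases (show (h m).level ≤ (h w).level by omega).lt_or_eq with h3 | h3
    · exact (H.lt_of_level_lt h3).le
    · exact (H.eq_of_single (B13.eq_of_level_eq h3 (by omega))
        (B13.single_iff.2 (by omega))).le

/-- Here the adjacent level is 0 or 3. Level 3 may be a longer chain, so its greatest element is
taken. -/
theorem exists_isGLB [Finite P] (H : IsBlowup h) (u v : P) : ∃ m, IsGLB {u, v} m := by
  by_cases huv : u ≤ v
  · exact ⟨u, by simp [huv], fun w hw => hw (by simp)⟩
  by_cases hvu : v ≤ u
  · exact ⟨v, by simp [hvu], fun w hw => hw (by simp)⟩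
  obtain ⟨hne, hl, h1⟩ := H.incomparable huv hvu
  obtain ⟨m, hm, hmax⟩ := H.exists_greatest_level (k := (h u).level - 1) (by omega)
  refine ⟨m, ?_, fun w hw => ?_⟩
  · rintro w (rfl | rfl) <;> exact (H.lt_of_level_lt (by omega)).le
  · have h2 := H.level_lt_of_le_of_le hl hne (hw (by simp)) (hw (by simp))
    rcases (show (h w).level ≤ (h m).level by omega).lt_or_eq with h3 | h3
    · exact (H.lt_of_level_lt h3).le
    · exact hmax w (h3.trans hm)

theorem covBy_level (H : IsBlowup h) {u v : P} (huv : u ⋖ v) :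
    h u = h v ∨ (h u).level + 1 = (h v).level :=
  H.eq_or_level_succ huv.lt fun _ h1 h2 => huv.2 h1 h2

theorem subsingleton_lower (H : IsBlowup h) {u : P}
    (hu : ¬ ((h u).level = 2 ∨ (h u).level = 5)) : {c | c ⋖ u}.Subsingleton := by
  have comp : ∀ {c d}, c ⋖ u → d ⋖ u → c ≤ d → c = d := fun hc hd hcd =>
    hcd.eq_of_not_lt fun hlt => hc.2 hlt hd.lt
  intro c hc d hd
  have h5 := (h u).level_le_five
  have : c ≤ d ∨ d ≤ c := by
    rcases H.covBy_level hc with h1 | h1 <;> rcases H.covBy_level hd with h2 | h2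
    · exact H.le_total (h1.trans h2.symm)
    · exact Or.inr (H.lt_of_level_lt (by rw [h1]; omega)).le
    · exact Or.inl (H.lt_of_level_lt (by rw [h2]; omega)).le
    · exact H.le_total (B13.eq_of_level_eq (by omega) (by omega))
  rcases this with h1 | h1
  exacts [comp hc hd h1, (comp hd hc h1).symm]

theorem subsingleton_upper (H : IsBlowup h) {u m : P} (hm : (h m).level = 3)
    (hmax : ∀ w, (h w).level = 3 → w ≤ m) (hum : u ≠ m) (hu : (h u).level ≠ 0) :
    {c | u ⋖ c}.Subsingleton := by
  have comp : ∀ {c d}, u ⋖ c → u ⋖ d → c ≤ d → c = d := fun hc hd hcd =>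
    hcd.eq_of_not_lt fun hlt => hd.2 hc.lt hlt
  intro c hc d hd
  have hc5 := (h c).level_le_five
  -- From the middle chain, only its top `m` is covered by elements of level 4.
  have h3 : ∀ c, u ⋖ c → (h u).level + 1 = (h c).level → (h u).level ≠ 3 := by
    intro c hc hl h3
    exact hc.2 ((hmax u h3).lt_of_ne hum) (H.lt_of_level_lt (by omega))
  have : c ≤ d ∨ d ≤ c := by
    rcases H.covBy_level hc with h1 | h1 <;> rcases H.covBy_level hd with h2 | h2
    · exact H.le_total (h1.symm.trans h2)
    · exact Or.inl (H.lt_of_level_lt (by rw [← h1]; omega)).le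
    · exact Or.inr (H.lt_of_level_lt (by rw [← h2]; omega)).le
    · have := h3 c hc h1
      exact H.le_total (B13.eq_of_level_eq (by omega) (by omega))
  rcases this with h1 | h1
  exacts [comp hc hd h1, (comp hd hc h1).symm]

/-- The lower covers of an element that is alone on its level correspond to the labels of the
previous level. -/
theorem ncard_lower [Finite P] (H : IsBlowup h) {u : P} {k : ℕ} (hu : (h u).level = k + 1)
    (hs : k + 1 = 2 ∨ k + 1 = 5) : {c | c ⋖ u}.ncard = {b : B13 | b.level = k}.ncard := by
  have hus := B13.single_iff.2 (show (h u).level = 0 ∨ _ by omega)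
  refine Set.ncard_congr (fun c _ => h c) ?_ ?_ ?_
  · intro c hc
    rcases H.covBy_level hc with h1 | h1
    · exact absurd (H.eq_of_single h1.symm hus) hc.lt.ne'
    · exact Nat.succ_injective (h1.trans hu)
  · intro c d hc hd hcd
    rcases H.le_total hcd with h1 | h1
    · exact h1.eq_of_not_lt fun hlt => hc.2 hlt hd.lt
    · exact (h1.eq_of_not_lt fun hlt => hd.2 hlt hc.lt).symm
  · intro b hb
    obtain ⟨w, hw⟩ := H.surjective b
    have hb : b.level = k := hb
    obtain ⟨c, hwc, hc⟩ := exists_le_covBy_of_lt (H.lt_of_level_lt (u := w) (v := u)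
      (by rw [hw, hb, hu]; omega))
    refine ⟨c, hc, ?_⟩
    rcases H.covBy_level hc with h1 | h1
    · exact absurd (H.eq_of_single h1.symm hus) hc.lt.ne'
    · rcases H.level_lt_or_eq hwc with h2 | h2
      · rw [hw] at h2; omega
      · exact h2.symm.trans hw

/-- Edges minus vertices is the sum over all elements of the number of lower covers minus one. The
elements labelled `0`, `a`, `1` contribute -1, 2, 1 and all others 0; the single component adds 1.
-/
theorem nullity_eq [Finite P] (H : IsBlowup h) : nullity P = 3 := by
  classical
  have := Fintype.ofFinite P
  obtain ⟨o, ho, hbot⟩ := H.exists_bot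
  obtain ⟨t, ht, -⟩ := H.exists_top
  obtain ⟨s, hs⟩ := H.surjective .a
  have h1 : {b : B13 | b.level = 1}.ncard = 3 := by
    have : {b : B13 | b.level = 1} = {.x, .c₁, .c₂} := by
      ext b; cases b <;> simp [B13.level]
    rw [this]
    exact Set.ncard_eq_three.2 ⟨_, _, _, by simp, by simp, by simp, rfl⟩
  have h4 : {b : B13 | b.level = 4}.ncard = 2 := by
    have : {b : B13 | b.level = 4} = {.y, .c₃} := by
      ext b; cases b <;> simp [B13.level]
    rw [this]
    exact Set.ncard_pair (by simp)
  have key : ∀ u : P, (({c | c ⋖ u}.ncard : ℤ) - 1) =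
      (if u = o then -1 else 0) + (if u = s then 2 else 0) + (if u = t then 1 else 0) := by
    intro u
    have e1 : u = o ↔ h u = .zero := ⟨fun e => e ▸ ho, fun e =>
      H.eq_of_single (e.trans ho.symm) (Or.inl e)⟩
    have e2 : u = s ↔ h u = .a := ⟨fun e => e ▸ hs, fun e =>
      H.eq_of_single (e.trans hs.symm) (Or.inr (Or.inl e))⟩
    have e3 : u = t ↔ h u = .one := ⟨fun e => e ▸ ht, fun e =>
      H.eq_of_single (e.trans ht.symm) (Or.inr (Or.inr e))⟩
    by_cases c1 : h u = .zero
    · have : {c | c ⋖ u} = ∅ := Set.eq_empty_of_forall_notMem fun c hc =>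
        (CovBy.lt hc).not_ge (e1.2 c1 ▸ hbot c)
      simp [e1, e2, e3, c1, this]
    by_cases c2 : h u = .a
    · rw [H.ncard_lower (k := 1) (by rw [c2]; rfl) (by omega), h1]
      simp [e1, e2, e3, c2]
    by_cases c3 : h u = .one
    · rw [H.ncard_lower (k := 4) (by rw [c3]; rfl) (by omega), h4]
      simp [e1, e2, e3, c3]
    have hsub : {c | c ⋖ u}.Subsingleton := H.subsingleton_lower fun hc =>
      not_or.2 ⟨c1, not_or.2 ⟨c2, c3⟩⟩ (B13.single_iff.2 (by omega))
    obtain ⟨c, -, hc⟩ := exists_le_covBy_of_lt ((hbot u).lt_of_ne fun e => c1 (e ▸ ho))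
    rw [hsub.eq_singleton_of_mem hc]
    simp [e1, e2, e3, c1, c2, c3]
  have hsum : ∑ u : P, (({c | c ⋖ u}.ncard : ℤ) - 1) = 2 := by
    rw [Finset.sum_congr rfl fun u _ => key u]
    simp [Finset.sum_add_distrib]
  rw [nullity, card_connectedComponent_hasse hbot, ncard_edgeSet_hasse]
  rw [Finset.sum_sub_distrib] at hsum
  simp only [Finset.sum_const, Finset.card_univ, nsmul_eq_mul, mul_one] at hsum
  rw [Nat.card_eq_fintype_card]
  push_cast
  omega

end IsBlowup

/-- The reducible elements are the two bounds, the element labelled `a`, and the top of the middle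
chain. -/
theorem IsBlowup.isBlockOfType {L : Type*} [Lattice L] [Finite L] {h : L → B13}
    (H : IsBlowup h) : IsBlockOfType L 4 3 := by
  obtain ⟨o, ho, hbot⟩ := H.exists_bot
  obtain ⟨t, ht, htop⟩ := H.exists_top
  obtain ⟨s, hs⟩ := H.surjective .a
  obtain ⟨m, hm, hmax⟩ := H.exists_greatest_level (k := 3) (by omega)
  obtain ⟨p₁, hp₁⟩ := H.surjective .x
  obtain ⟨q₁, hq₁⟩ := H.surjective .c₁
  obtain ⟨p₂, hp₂⟩ := H.surjective .y
  obtain ⟨q₂, hq₂⟩ := H.surjective .c₃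
  have l₁ : (h p₁).level = (h q₁).level := by rw [hp₁, hq₁]; rfl
  have l₂ : (h p₂).level = (h q₂).level := by rw [hp₂, hq₂]; rfl
  have n₁ : h p₁ ≠ h q₁ := by simp [hp₁, hq₁]
  have n₂ : h p₂ ≠ h q₂ := by simp [hp₂, hq₂]
  have e₁ : (h p₁).level = 1 := by rw [hp₁]; rfl
  have e₂ : (h p₂).level = 4 := by rw [hp₂]; rfl
  have eo : (h o).level = 0 := by rw [ho]; rfl
  have es : (h s).level = 2 := by rw [hs]; rfl
  have et : (h t).level = 5 := by rw [ht]; rfl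
  have ne : ∀ {u v : L}, (h u).level ≠ (h v).level → u ≠ v := fun h1 h2 => h1 (by rw [h2])
  have ro : MeetReducible o := by
    refine ⟨p₁, q₁, ne (by omega), ne (by omega), ?_⟩
    have h1 := H.level_lt_of_le_of_le l₁ n₁ (inf_le_left : p₁ ⊓ q₁ ≤ p₁) inf_le_right
    exact H.eq_of_single (B13.eq_of_level_eq (by omega) (by omega)) (B13.single_iff.2 (by omega))
  have rs : JoinReducible s := by
    refine ⟨p₁, q₁, ne (by omega), ne (by omega), ?_⟩
    have h1 := H.lt_level_of_le_of_le l₁ n₁ (le_sup_left : p₁ ≤ p₁ ⊔ q₁) le_sup_right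
    have h2 : p₁ ⊔ q₁ ≤ s :=
      sup_le (H.lt_of_level_lt (by omega)).le (H.lt_of_level_lt (by omega)).le
    have h3 := H.level_le h2
    exact H.eq_of_single (B13.eq_of_level_eq (by omega) (by omega)) (B13.single_iff.2 (by omega))
  have rm : MeetReducible m := by
    refine ⟨p₂, q₂, ne (by omega), ne (by omega), ?_⟩
    have h1 := H.level_lt_of_le_of_le l₂ n₂ (inf_le_left : p₂ ⊓ q₂ ≤ p₂) inf_le_right
    have h2 : m ≤ p₂ ⊓ q₂ :=
      le_inf (H.lt_of_level_lt (by omega)).le (H.lt_of_level_lt (by omega)).le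
    have h3 := H.level_le h2
    exact le_antisymm (hmax _ (by omega)) h2
  have rt : JoinReducible t := by
    refine ⟨p₂, q₂, ne (by omega), ne (by omega), ?_⟩
    have h1 := H.lt_level_of_le_of_le l₂ n₂ (le_sup_left : p₂ ≤ p₂ ⊔ q₂) le_sup_right
    have h3 := (h (p₂ ⊔ q₂)).level_le_five
    exact H.eq_of_single (B13.eq_of_level_eq (by omega) (by omega)) (B13.single_iff.2 (by omega))
  have hred : reducibles L = {o, s, m, t} := by
    ext u
    simp only [reducibles, Set.mem_ofPred_eq, Set.mem_insert_iff, Set.mem_singleton_iff]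
    constructor
    · intro hu
      by_contra! hc
      obtain ⟨uo, us, um, ut⟩ := hc
      have single : ∀ v, (h u).level = (h v).level →
          ((h u).level = 0 ∨ (h u).level = 2 ∨ (h u).level = 5) → u = v := fun v hv hl =>
        H.eq_of_single (B13.eq_of_level_eq hv (by omega)) (B13.single_iff.2 hl)
      rcases hu with hu | hu
      · exact hu.not_subsingleton (H.subsingleton_upper hm hmax um fun hl =>
          uo (single o (by omega) (by omega)))
      · refine hu.not_subsingleton (H.subsingleton_lower fun hl => ?_)
        rcases hl with hl | hl
        · exact us (single s (by omega) (by omega))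
        · exact ut (single t (by omega) (by omega))
    · rintro (rfl | rfl | rfl | rfl)
      exacts [Or.inl ro, Or.inr rs, Or.inl rm, Or.inr rt]
  refine ⟨⟨⟨o, hbot, ro⟩, ⟨t, htop, rt⟩⟩, ?_, ?_, H.nullity_eq⟩
  · rw [hred, Set.ncard_insert_of_notMem, Set.ncard_insert_of_notMem, Set.ncard_pair]
    · exact ne (by omega)
    · rintro (h1 | h1) <;> exact ne (by omega) h1
    · rintro (h1 | h1 | h1) <;> exact ne (by omega) h1
  · rw [hred]
    intro u hu v hv _
    have tot : (h u).level < (h v).level ∨ u = v ∨ (h v).level < (h u).level := by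
      rcases hu with rfl | rfl | rfl | rfl <;> rcases hv with rfl | rfl | rfl | rfl <;>
        first | exact Or.inr (Or.inl rfl) | exact Or.inl (by omega) |
          exact Or.inr (Or.inr (by omega))
    rcases tot with h1 | h1 | h1
    exacts [Or.inl (H.lt_of_level_lt h1).le, Or.inl h1.le, Or.inr (H.lt_of_level_lt h1).le]

/-! ### Chain sizes as a complete isomorphism invariant -/

instance : Fintype B13 where
  elems := ⟨{.zero, .x, .c₁, .c₂, .a, .b, .y, .c₃, .one}, by simp⟩
  complete b := by cases b <;> simp

theorem B13.univ_val : (Finset.univ : Finset B13).val =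
    {.zero, .x, .c₁, .c₂, .a, .b, .y, .c₃, .one} := rfl

theorem exists_perm_of_map_eq {ι α : Type*} [Fintype ι] {f g : ι → α}
    (h : Finset.univ.val.map f = Finset.univ.val.map g) :
    ∃ σ : Equiv.Perm ι, ∀ i, g (σ i) = f i := by
  classical
  have key : ∀ c, Fintype.card {i // f i = c} = Fintype.card {i // g i = c} := by
    intro c
    have := congrArg (Multiset.count c) h
    rw [Multiset.count_map, Multiset.count_map] at this
    rw [Fintype.card_subtype, Fintype.card_subtype]
    simpa only [Finset.card_def, Finset.filter_val, eq_comm] using this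
  exact ⟨Equiv.ofFiberEquiv fun c => Fintype.equivOfCardEq (key c),
    fun i => Equiv.ofFiberEquiv_map _ i⟩

theorem exists_orderIso_of_total {α β : Type*} [PartialOrder α] [PartialOrder β] [Finite α]
    [Finite β] (hα : ∀ a b : α, a ≤ b ∨ b ≤ a) (hβ : ∀ a b : β, a ≤ b ∨ b ≤ a)
    (hc : Nat.card α = Nat.card β) : Nonempty (α ≃o β) := by
  classical
  have := Fintype.ofFinite α
  have := Fintype.ofFinite β
  let iα : LinearOrder α :=
    { (inferInstance : PartialOrder α) with le_total := hα, toDecidableLE := Classical.decRel _ }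
  let iβ : LinearOrder β :=
    { (inferInstance : PartialOrder β) with le_total := hβ, toDecidableLE := Classical.decRel _ }
  rw [Nat.card_eq_fintype_card, Nat.card_eq_fintype_card] at hc
  exact ⟨(Fintype.orderIsoFinOfCardEq α hc).symm.trans (Fintype.orderIsoFinOfCardEq β rfl)⟩

/-- The number of elements with a given label. -/
noncomputable def fiberCard {P : Type*} (h : P → B13) (b : B13) : ℕ := {u | h u = b}.ncard

theorem card_eq_sum_fiberCard {P : Type*} [Finite P] (h : P → B13) :
    Nat.card P = ∑ b, fiberCard h b := by
  rw [← Nat.card_congr (Equiv.sigmaFiberEquiv h), Nat.card_sigma]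
  rfl

/-- The multiset of sizes of the three chains between `0` and `a`. -/
noncomputable def lowerSizes {P : Type*} (h : P → B13) : Multiset ℕ :=
  {fiberCard h .x, fiberCard h .c₁, fiberCard h .c₂}

/-- The multiset of sizes of the two chains between `b` and `1`. -/
noncomputable def upperSizes {P : Type*} (h : P → B13) : Multiset ℕ :=
  {fiberCard h .y, fiberCard h .c₃}

namespace IsBlowup

variable {P : Type*} [PartialOrder P] {h : P → B13}

theorem fiberCard_pos [Finite P] (H : IsBlowup h) (b : B13) : 0 < fiberCard h b := by
  obtain ⟨u, hu⟩ := H.surjective b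
  exact (Set.ncard_pos).2 ⟨u, hu⟩

theorem fiberCard_single [Finite P] (H : IsBlowup h) {b : B13}
    (hb : b = .zero ∨ b = .a ∨ b = .one) : fiberCard h b = 1 := by
  obtain ⟨u, hu⟩ := H.surjective b
  refine Set.ncard_eq_one.2 ⟨u, Set.eq_singleton_iff_unique_mem.2 ⟨hu, fun v hv => ?_⟩⟩
  have hv : h v = b := hv
  exact H.eq_of_single (hv.trans hu.symm) (hv ▸ hb)

theorem card_eq [Finite P] (H : IsBlowup h) :
    Nat.card P = 3 + (lowerSizes h).sum + fiberCard h .b + (upperSizes h).sum := by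
  rw [card_eq_sum_fiberCard h, Finset.sum, B13.univ_val]
  simp [lowerSizes, upperSizes, H.fiberCard_single]
  ring

theorem orderIso_of_fiberCard {Q : Type*} [PartialOrder Q] [Finite P] [Finite Q] {g : Q → B13}
    (H : IsBlowup h) (G : IsBlowup g) (hc : ∀ b, fiberCard h b = fiberCard g b) :
    Nonempty (P ≃o Q) := by
  have key : ∀ b, Nonempty ({u // h u = b} ≃o {v // g v = b}) := fun b =>
    exists_orderIso_of_total (fun u v => H.le_total (u.2.trans v.2.symm))
      (fun u v => G.le_total (u.2.trans v.2.symm)) (hc b)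
  let e := fun b => (key b).some
  let E : P ≃ Q := Equiv.ofFiberEquiv fun b => (e b).toEquiv
  have hE : ∀ u, g (E u) = h u := fun u => Equiv.ofFiberEquiv_map _ u
  have hsame : ∀ u v, h u = h v → (E u ≤ E v ↔ u ≤ v) := by
    intro u v huv
    -- Leaving the label `b` free allows `u` and `v` to be placed in one and the same fibre.
    have h1 : ∀ b (hu : h u = b), E u = (e b ⟨u, hu⟩).1 := by rintro _ rfl; rfl
    have h2 : ∀ b (hv : h v = b), E v = (e b ⟨v, hv⟩).1 := by rintro _ rfl; rfl
    rw [h1 _ huv, h2 _ rfl, Subtype.coe_le_coe, OrderIso.le_iff_le]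
    exact Iff.rfl
  refine ⟨⟨E, fun {u v} => ?_⟩⟩
  constructor
  · intro huv
    rcases G.level_lt_or_eq huv with h1 | h1
    · rw [hE, hE] at h1
      exact (H.lt_of_level_lt h1).le
    · rw [hE, hE] at h1
      exact (hsame u v h1).1 huv
  · intro huv
    rcases H.level_lt_or_eq huv with h1 | h1
    · rw [← hE, ← hE] at h1
      exact (G.lt_of_level_lt h1).le
    · exact (hsame u v h1).2 huv

theorem perm_comp (H : IsBlowup h) (σ : Equiv.Perm B13) (hσ : ∀ b, (σ b).level = b.level) :
    IsBlowup (σ ∘ h) where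
  level_lt_or_eq huv := by
    simp only [Function.comp, hσ, σ.injective.eq_iff]
    exact H.level_lt_or_eq huv
  lt_of_level_lt huv := by
    simp only [Function.comp, hσ] at huv
    exact H.lt_of_level_lt huv
  le_total huv := H.le_total (σ.injective huv)
  surjective := σ.surjective.comp H.surjective
  eq_of_single huv hs := by
    rw [B13.single_iff] at hs
    simp only [Function.comp, hσ] at hs
    exact H.eq_of_single (σ.injective huv) (B13.single_iff.2 hs)

theorem map_level_fiberCard [Finite P] (H : IsBlowup h) :
    Finset.univ.val.map (fun b : B13 => (b.level, fiberCard h b)) =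
      {(0, 1), (2, 1), (3, fiberCard h .b), (5, 1)} + (lowerSizes h).map (Prod.mk 1) +
        (upperSizes h).map (Prod.mk 4) := by
  rw [B13.univ_val]
  simp only [lowerSizes, upperSizes, Multiset.insert_eq_cons, Multiset.map_cons,
    Multiset.map_singleton, B13.level, H.fiberCard_single (Or.inl rfl),
    H.fiberCard_single (Or.inr (Or.inl rfl)), H.fiberCard_single (Or.inr (Or.inr rfl))]
  simp only [← Multiset.singleton_add]
  abel

/-- The sizes determine the multiset of pairs (level, fibre size), so some level-preserving
permutation of the labels matches all fibre sizes; relabelling by it leaves a blow-up. -/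
theorem orderIso_of_sizes {Q : Type*} [PartialOrder Q] [Finite P] [Finite Q] {g : Q → B13}
    (H : IsBlowup h) (G : IsBlowup g) (hl : lowerSizes h = lowerSizes g)
    (hu : upperSizes h = upperSizes g) (hb : fiberCard h .b = fiberCard g .b) :
    Nonempty (P ≃o Q) := by
  have hm := H.map_level_fiberCard
  rw [hl, hu, hb, ← G.map_level_fiberCard] at hm
  obtain ⟨σ, hσ⟩ := exists_perm_of_map_eq hm
  simp only [Prod.mk.injEq] at hσ
  refine (H.perm_comp σ fun b => (hσ b).1).orderIso_of_fiberCard G fun b => ?_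
  obtain ⟨b, rfl⟩ := σ.surjective b
  rw [(hσ b).2]
  simp only [fiberCard, Function.comp, σ.injective.eq_iff]

/-- Within one level, the fibre of `u` consists of the elements comparable to `u`. The right-hand
side does not mention `h`, so once `A` is described through the order alone, the sizes do not depend
on the labelling. -/
theorem fiberCard_map_eq [Finite P] [DecidableEq (Set P)] [Fintype P] (H : IsBlowup h)
    (I : Finset B13) (A : P → Prop) [DecidablePred A] (hA : ∀ u, A u ↔ h u ∈ I)
    (hI : ∀ b ∈ I, ∀ c ∈ I, b.level = c.level) :
    I.val.map (fiberCard h) =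
      ((Finset.univ.filter A).image fun u => {v | A v ∧ (v ≤ u ∨ u ≤ v)}).val.map Set.ncard := by
  have h1 : (Finset.univ.filter A).image (fun u => {v | A v ∧ (v ≤ u ∨ u ≤ v)}) =
      I.image fun b => {u | h u = b} := by
    have h2 : ∀ u, A u → {v | A v ∧ (v ≤ u ∨ u ≤ v)} = {v | h v = h u} := by
      intro u hu
      ext v
      constructor
      · rintro ⟨hv, huv⟩
        have hl := hI _ ((hA v).1 hv) _ ((hA u).1 hu)
        rcases huv with huv | huv
        · exact (H.level_lt_or_eq huv).resolve_left hl.not_lt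
        · exact ((H.level_lt_or_eq huv).resolve_left hl.not_gt).symm
      · intro hv
        have hv : h v = h u := hv
        exact ⟨(hA v).2 (hv ▸ (hA u).1 hu), H.le_total hv⟩
    ext s
    simp only [Finset.mem_image, Finset.mem_filter, Finset.mem_univ, true_and]
    constructor
    · rintro ⟨u, hu, rfl⟩
      exact ⟨h u, (hA u).1 hu, (h2 u hu).symm⟩
    · rintro ⟨b, hb, rfl⟩
      obtain ⟨u, rfl⟩ := H.surjective b
      exact ⟨u, (hA u).2 hb, h2 u ((hA u).2 hb)⟩
  have hinj : Set.InjOn (fun b => {u | h u = b}) (I : Set B13) := by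
    intro b _ c _ hbc
    obtain ⟨u, rfl⟩ := H.surjective b
    exact (Set.ext_iff.1 hbc u).1 rfl
  rw [h1, Finset.image_val_of_injOn hinj, Multiset.map_map]
  rfl

/-- Being a member of a three-element antichain characterizes the elements between `0` and `a`. -/
theorem level_eq_one_iff (H : IsBlowup h) (u : P) : (h u).level = 1 ↔
    ∃ v w, (¬ u ≤ v ∧ ¬ v ≤ u) ∧ (¬ u ≤ w ∧ ¬ w ≤ u) ∧ (¬ v ≤ w ∧ ¬ w ≤ v) := by
  constructor
  · intro hu
    have inc : ∀ {u v : P}, h u ≠ h v → (h u).level = (h v).level → ¬ u ≤ v := fun hne hl hle =>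
      (H.level_lt_or_eq hle).elim (fun h1 => hl.not_lt h1) hne
    have mk : ∀ b c : B13, h u ≠ b → h u ≠ c → b ≠ c → b.level = 1 → c.level = 1 →
        ∃ v w, (¬ u ≤ v ∧ ¬ v ≤ u) ∧ (¬ u ≤ w ∧ ¬ w ≤ u) ∧ (¬ v ≤ w ∧ ¬ w ≤ v) := by
      intro b c hb hc hbc lb lc
      obtain ⟨v, rfl⟩ := H.surjective b
      obtain ⟨w, rfl⟩ := H.surjective c
      exact ⟨v, w, ⟨inc hb (by omega), inc hb.symm (by omega)⟩,
        ⟨inc hc (by omega), inc hc.symm (by omega)⟩,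
        ⟨inc hbc (by omega), inc hbc.symm (by omega)⟩⟩
    have hcase : h u = .x ∨ h u = .c₁ ∨ h u = .c₂ := by
      revert hu; cases h u <;> simp [B13.level]
    rcases hcase with hu | hu | hu
    · exact mk .c₁ .c₂ (by simp [hu]) (by simp [hu]) (by simp) rfl rfl
    · exact mk .x .c₂ (by simp [hu]) (by simp [hu]) (by simp) rfl rfl
    · exact mk .x .c₁ (by simp [hu]) (by simp [hu]) (by simp) rfl rfl
  · rintro ⟨v, w, huv, huw, hvw⟩
    obtain ⟨n1, l1, h1⟩ := H.incomparable huv.1 huv.2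
    obtain ⟨n2, l2, -⟩ := H.incomparable huw.1 huw.2
    obtain ⟨n3, -, -⟩ := H.incomparable hvw.1 hvw.2
    refine h1.resolve_right fun h4 => ?_
    have : ∀ b c d : B13, b ≠ c → b ≠ d → c ≠ d → b.level = c.level → b.level = d.level →
        b.level ≠ 4 := by
      intro b c d
      cases b <;> try simp
      all_goals cases c <;> try simp
      all_goals cases d <;> simp [B13.level]
    exact this _ _ _ n1 n2 n3 l1 l2 h4

theorem level_eq_four_iff (H : IsBlowup h) (u : P) : (h u).level = 4 ↔
    (∃ v, ¬ u ≤ v ∧ ¬ v ≤ u) ∧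
      ¬ ∃ v w, (¬ u ≤ v ∧ ¬ v ≤ u) ∧ (¬ u ≤ w ∧ ¬ w ≤ u) ∧ (¬ v ≤ w ∧ ¬ w ≤ v) := by
  rw [← H.level_eq_one_iff]
  constructor
  · intro hu
    have hcase : ∃ c, h u ≠ c ∧ c.level = 4 := by
      revert hu
      cases h u
      case y => exact fun _ => ⟨.c₃, by simp, rfl⟩
      case c₃ => exact fun _ => ⟨.y, by simp, rfl⟩
      all_goals simp [B13.level]
    obtain ⟨c, hc, hl⟩ := hcase
    obtain ⟨v, rfl⟩ := H.surjective c
    refine ⟨⟨v, fun hle => ?_, fun hle => ?_⟩, by omega⟩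
    · rcases H.level_lt_or_eq hle with h1 | h1
      exacts [absurd h1 (by omega), hc h1]
    · rcases H.level_lt_or_eq hle with h1 | h1
      exacts [absurd h1 (by omega), hc h1.symm]
  · rintro ⟨⟨v, h1, h2⟩, h3⟩
    exact (H.incomparable h1 h2).2.2.resolve_left h3

/-- Antichains identify levels 1 and 4 through the order alone, which fixes the lower and upper
sizes; the total cardinality then fixes the middle one. -/
theorem sizes_unique [Finite P] {g : P → B13} (H : IsBlowup h) (G : IsBlowup g) :
    lowerSizes h = lowerSizes g ∧ upperSizes h = upperSizes g ∧
      fiberCard h .b = fiberCard g .b := by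
  classical
  have := Fintype.ofFinite P
  have h1 : ∀ b : B13, b ∈ (⟨{.x, .c₁, .c₂}, by simp⟩ : Finset B13) ↔ b.level = 1 := by
    intro b; cases b <;> simp [B13.level]
  have h4 : ∀ b : B13, b ∈ (⟨{.y, .c₃}, by simp⟩ : Finset B13) ↔ b.level = 4 := by
    intro b; cases b <;> simp [B13.level]
  have hl : lowerSizes h = lowerSizes g :=
    (H.fiberCard_map_eq _ _ (fun u => ((h1 _).trans (H.level_eq_one_iff u)).symm)
      fun b hb c hc => ((h1 b).1 hb).trans ((h1 c).1 hc).symm).trans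
    (G.fiberCard_map_eq _ _ (fun u => ((h1 _).trans (G.level_eq_one_iff u)).symm)
      fun b hb c hc => ((h1 b).1 hb).trans ((h1 c).1 hc).symm).symm
  have hu : upperSizes h = upperSizes g :=
    (H.fiberCard_map_eq _ _ (fun u => ((h4 _).trans (H.level_eq_four_iff u)).symm)
      fun b hb c hc => ((h4 b).1 hb).trans ((h4 c).1 hc).symm).trans
    (G.fiberCard_map_eq _ _ (fun u => ((h4 _).trans (G.level_eq_four_iff u)).symm)
      fun b hb c hc => ((h4 b).1 hb).trans ((h4 c).1 hc).symm).symm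
  refine ⟨hl, hu, ?_⟩
  have := H.card_eq.symm.trans G.card_eq
  rw [hl, hu] at this
  omega

end IsBlowup

/-! ### Realizing prescribed chain sizes -/

section Construction

/-- The order on a linearly ordered set that first compares the levels of the labels, and breaks
ties between elements with equal labels by the given order. -/
abbrev labelOrder {α : Type*} [LinearOrder α] (h : α → B13) : PartialOrder α where
  le u v := (h u).level < (h v).level ∨ h u = h v ∧ u ≤ v
  lt u v := ((h u).level < (h v).level ∨ h u = h v ∧ u ≤ v) ∧
    ¬ ((h v).level < (h u).level ∨ h v = h u ∧ v ≤ u)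
  le_refl u := Or.inr ⟨rfl, le_rfl⟩
  le_trans u v w := by
    rintro (h1 | ⟨h1, h1'⟩) (h2 | ⟨h2, h2'⟩)
    · exact Or.inl (h1.trans h2)
    · exact Or.inl (h2 ▸ h1)
    · exact Or.inl (h1 ▸ h2)
    · exact Or.inr ⟨h1.trans h2, h1'.trans h2'⟩
  le_antisymm u v := by
    rintro (h1 | ⟨h1, h1'⟩) (h2 | ⟨h2, h2'⟩)
    · exact absurd h1 h2.asymm
    · rw [h2] at h1; exact absurd h1 (lt_irrefl _)
    · rw [h1] at h2; exact absurd h2 (lt_irrefl _)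
    · exact le_antisymm h1' h2'

theorem isBlowup_labelOrder {α : Type*} [LinearOrder α] [Finite α] (h : α → B13)
    (hpos : ∀ b, 0 < fiberCard h b) (h1 : ∀ b, b = .zero ∨ b = .a ∨ b = .one → fiberCard h b = 1) :
    @IsBlowup α (labelOrder h) h := by
  let _ := labelOrder h
  refine @IsBlowup.mk α (labelOrder h) h (fun huv => huv.imp_right And.left) ?_ ?_ ?_ ?_
  · intro u v huv
    refine lt_of_le_of_ne (Or.inl huv) ?_
    rintro rfl
    exact lt_irrefl _ huv
  · intro u v huv
    rcases le_total u v with h2 | h2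
    exacts [Or.inl (Or.inr ⟨huv, h2⟩), Or.inr (Or.inr ⟨huv.symm, h2⟩)]
  · intro b
    obtain ⟨u, hu⟩ := (Set.ncard_pos).1 (hpos b)
    exact ⟨u, hu⟩
  · intro u v huv hs
    obtain ⟨w, hw⟩ := Set.ncard_eq_one.1 (h1 _ hs)
    have hu : u ∈ {w | h w = h u} := rfl
    have hv : v ∈ {w | h w = h u} := huv.symm
    rw [hw] at hu hv
    exact hu.trans hv.symm

theorem exists_fiberCard_eq {j : ℕ} (n : B13 → ℕ) (hn : ∑ b, n b = j) :
    ∃ h : Fin j → B13, ∀ b, fiberCard h b = n b := by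
  have e : (Σ b, Fin (n b)) ≃ Fin j := Fintype.equivFinOfCardEq (by simp [hn])
  refine ⟨fun u => (e.symm u).1, fun b => ?_⟩
  rw [fiberCard, ← Nat.card_coe_set_eq]
  have e1 : ↥{u | (e.symm u).1 = b} ≃ {p : Σ b, Fin (n b) // p.1 = b} :=
    e.symm.subtypeEquiv fun _ => Iff.rfl
  rw [Nat.card_congr (e1.trans (Equiv.sigmaSubtype b)), Nat.card_fin]

/-- A lattice structure on a partial order in which any two elements have bounds. -/
noncomputable abbrev latticeOfBounds {α : Type*} (p : PartialOrder α)
    (hs : ∀ u v : α, ∃ m, IsLUB {u, v} m) (hi : ∀ u v : α, ∃ m, IsGLB {u, v} m) : Lattice α where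
  __ := p
  sup u v := (hs u v).choose
  inf u v := (hi u v).choose
  le_sup_left u v := (hs u v).choose_spec.1 (by simp)
  le_sup_right u v := (hs u v).choose_spec.1 (by simp)
  sup_le u v w h1 h2 := (hs u v).choose_spec.2 (by rintro x (rfl | rfl) <;> assumption)
  inf_le_left u v := (hi u v).choose_spec.1 (by simp)
  inf_le_right u v := (hi u v).choose_spec.1 (by simp)
  le_inf u v w h1 h2 := (hi v w).choose_spec.2 (by rintro x (rfl | rfl) <;> assumption)

end Construction

/-! ### Duality between `B13` and `B14` -/

section Duality

open OrderDual

variable {P : Type*} [PartialOrder P]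

theorem covBy_dual_iff {x y : Pᵒᵈ} : x ⋖ y ↔ ofDual y ⋖ ofDual x := ofDual_covBy_ofDual_iff.symm

theorem toDual_mem_irr {x : P} : toDual x ∈ Irr Pᵒᵈ ↔ x ∈ Irr P := by
  change ({y | y ⋖ toDual x}.Subsingleton ∧ {y | toDual x ⋖ y}.Subsingleton) ↔ _
  simp only [covBy_dual_iff]
  exact and_comm

theorem toDual_mem_irrStar {x : P} : toDual x ∈ IrrStar Pᵒᵈ ↔ x ∈ IrrStar P := by
  change ((∃! y, y ⋖ toDual x) ∧ (∃! y, toDual x ⋖ y)) ↔ _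
  simp only [covBy_dual_iff]
  exact and_comm

theorem IsRetractible.toDual {x : P} (h : IsRetractible x) :
    IsRetractible (OrderDual.toDual x) := by
  refine ⟨toDual_mem_irr.2 h.1, h.2.imp ?_ ?_⟩
  · rintro h ⟨y, hy, z, hz, h1, h2⟩
    exact h ⟨ofDual z, fun hc => hz (toDual_mem_irr.2 hc), ofDual y,
      fun hc => hy (toDual_mem_irr.2 hc), covBy_dual_iff.1 h2, covBy_dual_iff.1 h1⟩
  · rintro ⟨y, hy, z, hz, h1, h2, h3⟩
    exact ⟨OrderDual.toDual z, fun hc => hz (toDual_mem_irr.1 hc), OrderDual.toDual y,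
      fun hc => hy (toDual_mem_irr.1 hc), covBy_dual_iff.2 h2, covBy_dual_iff.2 h1,
      fun w hw hw' => h3 (ofDual w) hw' hw⟩

theorem IsPendant.toDual {x : P} (h : IsPendant x) : IsPendant (OrderDual.toDual x) := by
  rw [IsPendant] at h ⊢
  rw [← h]
  congr 1
  ext y
  simp only [SimpleGraph.mem_neighborSet, SimpleGraph.hasse_adj, covBy_dual_iff]
  exact or_comm

theorem RetractStep.dual {S T : Set P} (h : RetractStep S T) : RetractStep (P := Pᵒᵈ) S T := by
  obtain ⟨x, hx, hr, h⟩ := h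
  exact ⟨x, toDual_mem_irrStar.2 hx, hr.toDual, h⟩

theorem PendantStep.dual {S T : Set P} (h : PendantStep S T) : PendantStep (P := Pᵒᵈ) S T := by
  obtain ⟨x, hx, h⟩ := h
  exact ⟨x, hx.toDual, h⟩

theorem IsBasicRetract.dual (h : IsBasicRetract P) : IsBasicRetract Pᵒᵈ :=
  fun x hx hr => h (ofDual x) (toDual_mem_irrStar.1 hx) hr.toDual

theorem IsBasicBlockOf.dual {B : Type*} [PartialOrder B] (h : IsBasicBlockOf B P) :
    IsBasicBlockOf Bᵒᵈ Pᵒᵈ := by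
  obtain ⟨R, S, hR, hb, hS, hp, ⟨e⟩⟩ := h
  exact ⟨R, S, Relation.ReflTransGen.mono (fun _ _ h => RetractStep.dual (P := P) h) _ _ hR,
    hb.dual,
    Relation.ReflTransGen.mono (fun _ _ h => PendantStep.dual (P := P) h) _ _ hS,
    fun x hx => hp x (IsPendant.toDual (P := (↥S)ᵒᵈ) hx), ⟨e.dual⟩⟩

theorem nullity_dual : nullity Pᵒᵈ = nullity P := by
  have e : SimpleGraph.hasse Pᵒᵈ ≃g SimpleGraph.hasse P := SimpleGraph.hasseDualIso
  rw [nullity, nullity, ← Nat.card_coe_set_eq, ← Nat.card_coe_set_eq,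
    Nat.card_congr e.mapEdgeSet, Nat.card_congr e.toEquiv,
    Nat.card_congr e.connectedComponentEquiv]

theorem IsBlockOfType.dual {L : Type*} [Lattice L] {r k : ℕ} (h : IsBlockOfType L r k) :
    IsBlockOfType Lᵒᵈ r k := by
  have hred : reducibles Lᵒᵈ = reducibles L := Set.ext fun _ => or_comm
  refine ⟨⟨h.isBlock.2, h.isBlock.1⟩, ?_, ?_, nullity_dual.trans h.nullity_eq⟩
  · rw [hred]
    exact h.card_reducibles
  · rw [hred]
    exact h.comparable.symm

/-- Reversing the order on the fixed carrier `Fin j` is an involution on lattice structures that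
respects isomorphism. -/
theorem numBlocks_dual (B : Type*) [PartialOrder B] (j r k : ℕ) :
    numBlocks Bᵒᵈ j r k = numBlocks B j r k := by
  let e : BlockOn B j r k ≃ BlockOn Bᵒᵈ j r k :=
    { toFun := fun L => ⟨@OrderDual.instLattice (Fin j) L.1,
        @IsBlockOfType.dual (Fin j) L.1 r k L.2.1,
        @IsBasicBlockOf.dual (Fin j) L.1.toPartialOrder B _ L.2.2⟩
      invFun := fun L => ⟨@OrderDual.instLattice (Fin j) L.1,
        @IsBlockOfType.dual (Fin j) L.1 r k L.2.1,
        @IsBasicBlockOf.dual (Fin j) L.1.toPartialOrder Bᵒᵈ _ L.2.2⟩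
      left_inv := fun _ => rfl
      right_inv := fun _ => rfl }
  refine (Nat.card_congr (Quotient.congr e fun L M => ?_)).symm
  exact ⟨fun ⟨f⟩ => ⟨@OrderIso.dual (Fin j) (Fin j) L.1.toLE M.1.toLE f⟩,
    fun ⟨f⟩ => ⟨@OrderIso.dual (Fin j) (Fin j) (e L).1.toLE (e M).1.toLE f⟩⟩

end Duality

/-! ### Counting size types -/

section Count

/-- The partitions of `n` into `k` positive parts, as multisets. -/
def partitionParts (k n : ℕ) : Finset (Multiset ℕ) :=
  (Finset.univ.filter fun p : n.Partition => Multiset.card p.parts = k).image Nat.Partition.parts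

theorem card_partitionParts (k n : ℕ) : (partitionParts k n).card = numPartitions k n :=
  Finset.card_image_of_injective _ fun _ _ => Nat.Partition.ext

theorem mem_partitionParts {k n : ℕ} {s : Multiset ℕ} :
    s ∈ partitionParts k n ↔ Multiset.card s = k ∧ s.sum = n ∧ ∀ i ∈ s, 0 < i := by
  simp only [partitionParts, Finset.mem_image, Finset.mem_filter, Finset.mem_univ, true_and]
  constructor
  · rintro ⟨p, hp, rfl⟩
    exact ⟨hp, p.parts_sum, fun i => p.parts_pos⟩
  · rintro ⟨h1, h2, h3⟩
    exact ⟨⟨s, h3 _, h2⟩, h1, rfl⟩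

theorem card_le_sum {s : Multiset ℕ} (h : ∀ i ∈ s, 0 < i) : Multiset.card s ≤ s.sum := by
  simpa using Multiset.card_nsmul_le_sum (s := s) (a := 1) h

/-- The possible chain sizes of blow-ups with `j` elements: the number `r` of elements strictly
between `a` and `b`, the number `p` of elements up to `a`, and the sizes of the chains between `0`
and `a` and between `b` and `1`. -/
def sizeTypes (j : ℕ) : Finset (Σ _ : ℕ, Σ _ : ℕ, Multiset ℕ × Multiset ℕ) :=
  (Finset.Icc 0 (j - 9)).sigma fun r => (Finset.Icc 5 (j - r - 4)).sigma fun p =>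
    partitionParts 3 (p - 2) ×ˢ partitionParts 2 (j - p - r - 2)

theorem card_sizeTypes (j : ℕ) : (sizeTypes j).card =
    ∑ r ∈ Finset.Icc 0 (j - 9), ∑ p ∈ Finset.Icc 5 (j - r - 4),
      numPartitions 3 (p - 2) * numPartitions 2 (j - p - r - 2) := by
  simp [sizeTypes, card_partitionParts]

/-- The chain sizes of a blow-up. -/
noncomputable def sizeType {P : Type*} (h : P → B13) :
    Σ _ : ℕ, Σ _ : ℕ, Multiset ℕ × Multiset ℕ :=
  ⟨fiberCard h .b - 1, (lowerSizes h).sum + 2, lowerSizes h, upperSizes h⟩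

theorem IsBlowup.sizeType_mem {P : Type*} [PartialOrder P] [Finite P] {h : P → B13}
    (H : IsBlowup h) : sizeType h ∈ sizeTypes (Nat.card P) := by
  have hb := H.fiberCard_pos .b
  have h1 : ∀ i ∈ lowerSizes h, 0 < i := by
    simp [lowerSizes, H.fiberCard_pos]
  have h2 : ∀ i ∈ upperSizes h, 0 < i := by
    simp [upperSizes, H.fiberCard_pos]
  have c1 : Multiset.card (lowerSizes h) = 3 := rfl
  have c2 : Multiset.card (upperSizes h) = 2 := rfl
  have s1 := card_le_sum h1
  have s2 := card_le_sum h2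
  have hc := H.card_eq
  simp only [sizeTypes, sizeType, Finset.mem_sigma, Finset.mem_product, mem_partitionParts,
    Finset.mem_Icc]
  -- The three lower chains have at least 3 elements in all and the two upper ones at least 2. This
  -- yields `p ≥ 5`, `p ≤ j - r - 4` and `r ≤ j - 9`.
  refine ⟨⟨by omega, by omega⟩, ⟨by omega, by omega⟩, ⟨c1, by omega, h1⟩, c2, by omega, h2⟩

theorem sizeType_comp_equiv {P Q : Type*} (h : P → B13) (e : Q ≃ P) :
    sizeType (h ∘ e) = sizeType h := by
  have : ∀ b, fiberCard (h ∘ e) b = fiberCard h b := fun b => by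
    rw [fiberCard, fiberCard, ← Nat.card_coe_set_eq, ← Nat.card_coe_set_eq]
    exact Nat.card_congr (e.subtypeEquiv fun _ => Iff.rfl)
  simp only [sizeType, lowerSizes, upperSizes, this]

theorem IsBlowup.sizeType_unique {P : Type*} [PartialOrder P] [Finite P] {h g : P → B13}
    (H : IsBlowup h) (G : IsBlowup g) : sizeType h = sizeType g := by
  obtain ⟨h1, h2, h3⟩ := H.sizes_unique G
  simp only [sizeType, h1, h2, h3]

theorem IsBlowup.orderIso_of_sizeType {P : Type*} [PartialOrder P] [Finite P] {Q : Type*}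
    [PartialOrder Q] [Finite Q] {h : P → B13} {g : Q → B13} (H : IsBlowup h) (G : IsBlowup g)
    (hs : sizeType h = sizeType g) : Nonempty (P ≃o Q) := by
  have hH := H.fiberCard_pos .b
  have hG := G.fiberCard_pos .b
  simp only [sizeType, Sigma.mk.injEq, heq_eq_eq, Prod.mk.injEq] at hs
  exact H.orderIso_of_sizes G hs.2.2.1 hs.2.2.2 (by omega)

theorem exists_sizeType_eq {j : ℕ} {T} (hT : T ∈ sizeTypes j) :
    ∃ (h : Fin j → B13) (p : PartialOrder (Fin j)), @IsBlowup (Fin j) p h ∧ sizeType h = T := by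
  obtain ⟨r, p, M, N⟩ := T
  simp only [sizeTypes, Finset.mem_sigma, Finset.mem_product, mem_partitionParts,
    Finset.mem_Icc] at hT
  obtain ⟨⟨-, hr⟩, ⟨hp, hp'⟩, ⟨cM, sM, hM⟩, cN, sN, hN⟩ := hT
  obtain ⟨a, b, c, rfl⟩ := Multiset.card_eq_three.1 cM
  obtain ⟨d, e, rfl⟩ := Multiset.card_eq_two.1 cN
  simp only [Multiset.insert_eq_cons, Multiset.mem_cons, Multiset.mem_singleton, forall_eq_or_imp,
    forall_eq, Multiset.sum_cons, Multiset.sum_singleton] at hM hN sM sN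
  let n : B13 → ℕ
    | .zero => 1
    | .x => a
    | .c₁ => b
    | .c₂ => c
    | .a => 1
    | .b => r + 1
    | .y => d
    | .c₃ => e
    | .one => 1
  -- The bounds `5 ≤ p ≤ j - r - 4` force `j ≥ r + 9`, so no subtraction truncates and the sizes add
  -- up to `j`.
  obtain ⟨h, hh⟩ := exists_fiberCard_eq (j := j) n (by
    rw [Finset.sum, B13.univ_val]
    simp [n]
    omega)
  refine ⟨h, labelOrder h, isBlowup_labelOrder h (fun b => ?_) (fun b hb => ?_), ?_⟩
  · rw [hh]
    cases b <;> simp [n] <;> omega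
  · rw [hh]
    rcases hb with rfl | rfl | rfl <;> rfl
  · simp only [sizeType, lowerSizes, upperSizes, hh, n]
    simp
    omega

theorem BlockOn.exists_isBlowup {j : ℕ} (L : BlockOn B13 j 4 3) :
    ∃ h : Fin j → B13, @IsBlowup (Fin j) L.1.toPartialOrder h :=
  @IsBranching.exists_isBlowup (Fin j) L.1.toPartialOrder _
    (@IsBlock.isBranching (Fin j) L.1 (@IsBlockOfType.isBlock (Fin j) L.1 _ _ L.2.1)) L.2.2

theorem exists_blockOn {j : ℕ} {h : Fin j → B13} {p : PartialOrder (Fin j)}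
    (H : @IsBlowup (Fin j) p h) :
    ∃ L : BlockOn B13 j 4 3, L.1.toPartialOrder = p := by
  let L := latticeOfBounds p (@IsBlowup.exists_isLUB _ p _ H) (@IsBlowup.exists_isGLB _ p _ _ H)
  have hL : @IsBlockOfType (Fin j) L 4 3 := @IsBlowup.isBlockOfType (Fin j) L _ h H
  have hb := @IsBlock.isBranching (Fin j) L (@IsBlockOfType.isBlock (Fin j) L _ _ hL)
  exact ⟨⟨L, hL, @IsBlowup.isBasicBlockOf (Fin j) p _ h H hb⟩, rfl⟩

/-- The size type of an arbitrarily chosen labelling is a bijection from isomorphism classes to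
`sizeTypes j`. -/
theorem numBlocks_B13 (j : ℕ) : numBlocks B13 j 4 3 = (sizeTypes j).card := by
  choose f hf using fun L : BlockOn B13 j 4 3 => L.exists_isBlowup
  have hmem : ∀ L, sizeType (f L) ∈ sizeTypes j := fun L => by
    have := @IsBlowup.sizeType_mem (Fin j) L.1.toPartialOrder _ _ (hf L)
    rwa [Nat.card_fin] at this
  have hinv : ∀ (L M : BlockOn B13 j 4 3), blockSetoid B13 j 4 3 L M →
      sizeType (f L) = sizeType (f M) := by
    rintro L M ⟨e⟩
    -- The labelling of `M`, pulled back along `e`, is a second labelling of `L`, hence has the same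
    -- size type as the chosen one.
    have he := @IsBlowup.comp_orderIso (Fin j) M.1.toPartialOrder _ (hf M) (Fin j)
      L.1.toPartialOrder e
    rw [← sizeType_comp_equiv (f M) (@RelIso.toEquiv _ _ _ _ e)]
    exact @IsBlowup.sizeType_unique (Fin j) L.1.toPartialOrder _ _ _ (hf L) he
  let F : Quotient (blockSetoid B13 j 4 3) → sizeTypes j :=
    Quotient.lift (fun L => ⟨sizeType (f L), hmem L⟩) fun L M h => Subtype.ext (hinv L M h)
  have hF : Function.Bijective F := by
    constructor
    · intro q q'
      induction q using Quotient.inductionOn with | _ L =>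
      induction q' using Quotient.inductionOn with | _ M =>
      intro h
      exact Quotient.sound (@IsBlowup.orderIso_of_sizeType (Fin j) L.1.toPartialOrder _ (Fin j)
        M.1.toPartialOrder _ _ _ (hf L) (hf M) (congrArg Subtype.val h))
    · rintro ⟨T, hT⟩
      obtain ⟨h, p, H, rfl⟩ := exists_sizeType_eq hT
      obtain ⟨L, rfl⟩ := exists_blockOn H
      exact ⟨Quotient.mk _ L, Subtype.ext
        (@IsBlowup.sizeType_unique (Fin j) L.1.toPartialOrder _ _ _ (hf L) H)⟩
  rw [numBlocks, Nat.card_eq_of_bijective F hF, Nat.card_eq_fintype_card, Fintype.card_coe]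

end Count

end LatticeCount

theorem mainTheorem12 (j : ℕ) (hj : 9 ≤ j) :
    LatticeCount.numBlocks LatticeCount.B13 j 4 3 =
        ∑ r ∈ Finset.Icc 0 (j - 9), ∑ p ∈ Finset.Icc 5 (j - r - 4),
          LatticeCount.numPartitions 3 (p - 2) * LatticeCount.numPartitions 2 (j - p - r - 2) ∧
      LatticeCount.numBlocks LatticeCount.B14 j 4 3 =
        ∑ r ∈ Finset.Icc 0 (j - 9), ∑ p ∈ Finset.Icc 5 (j - r - 4),
          LatticeCount.numPartitions 3 (p - 2) * LatticeCount.numPartitions 2 (j - p - r - 2) := by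
  have h := (LatticeCount.numBlocks_B13 j).trans (LatticeCount.card_sizeTypes j)
  exact ⟨h, (LatticeCount.numBlocks_dual _ j 4 3).trans h⟩
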